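/- **Proposition 4.3 (string and dilaton equations).** For partitions $\lambda,\mu$ of $d$ let $\chi^\lambda_\mu$ be the value of the irreducible character of $S_d$ associated with $\lambda$ on permutations of cycle type $\mu$, and let $$p_3(\lambda)=\sum_{i\ge 1}\Big(\big(\lambda_i-i+\tfrac12\big)^3-\big(-i+\tfrac12\big)^3\Big).$$ Let $g\ge 0$ and let $n\ge 1$ be odd. For positive integers $\beta_1,\dots,\beta_n$ put $d=\beta_1+\dots+\beta_n$, $s=g+\frac{n-1}{2}$, and let $$H^{g,(2)}_{(d),\beta}=\frac{1}{d\,\beta_1\cdots\beta_n}\sum_{\lambda\vdash d}\chi^\lambda_{(d)}\Big(\frac{p_3(\lambda)}{3!}\Big)^{s}\chi^\lambda_\beta$$ be the one-part double Hurwitz number with completed $3$-cycles. Then $d\,H^{g,(2)}_{(d),\beta}/s!$ is given, for all positive integers $\beta_1,\dots,\beta_n$, by a unique polynomial $P_{g,n}\in\mathbb{Q}[\beta_1,\dots,\beta_n]$. For integers $b_1,\dots,b_n\ge 0$ with $b_1+\dots+b_n=g+\frac{n-1}{2}$, define the lowest-degree combinatorial Hodge integral by $$\langle\langle\tau_{b_1}\cdots\tau_{b_n}\Lambda_{2g}\rangle\rangle_g=(-1)^g\,[\beta_1^{b_1}\cdots\beta_n^{b_n}]\,P_{g,n},$$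 and let it be $0$ if some $b_i$ is negative. Then the following identities hold for all $g\ge0$, all odd $n\ge1$ and all integers $b_1,\dots,b_n\ge 0$. *String equation.* If $b_1+\dots+b_n=g+\frac{n+1}{2}$, then $$\langle\langle\tau_0^2\tau_{b_1}\cdots\tau_{b_n}\Lambda_{2g}\rangle\rangle_g=(2g+n)\sum_{i=1}^n\langle\langle\tau_{b_1}\cdots\tau_{b_{i-1}}\tau_{b_i-1}\tau_{b_{i+1}}\cdots\tau_{b_n}\Lambda_{2g}\rangle\rangle_g.$$ *Dilaton equation.* If $b_1+\dots+b_n=g+\frac{n-1}{2}$, then $$\langle\langle\tau_0\tau_1\tau_{b_1}\cdots\tau_{b_n}\Lambda_{2g}\rangle\rangle_g=(2g+n)\Big(g+\frac{n+1}{2}\Big)\langle\langle\tau_{b_1}\cdots\tau_{b_n}\Lambda_{2g}\rangle\rangle_g.$$ -/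

import Mathlib

noncomputable section

namespace CompletedHurwitz

/-! ### Irreducible characters of the symmetric groups -/

/-- The parts `λ₁ ≥ λ₂ ≥ …` of a partition, listed in weakly decreasing order. -/
def rows {d : ℕ} (lam : Nat.Partition d) : List ℕ :=
  lam.parts.sort (· ≥ ·)

theorem rows_sortedGE {d : ℕ} (lam : Nat.Partition d) : (rows lam).SortedGE :=
  (Multiset.pairwise_sort lam.parts (· ≥ ·)).sortedGE

theorem sum_rows {d : ℕ} (lam : Nat.Partition d) : (rows lam).sum = d := by
  rw [← Multiset.sum_coe, rows, Multiset.sort_eq, lam.parts_sum]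

/-- The Young diagram of a partition: the cell `(i, j)` lies in row `i` and column `j`. -/
def diagram {d : ℕ} (lam : Nat.Partition d) : YoungDiagram :=
  YoungDiagram.ofRowLens (rows lam) (rows_sortedGE lam)

theorem card_cellsOfRowLens (w : List ℕ) :
    (YoungDiagram.cellsOfRowLens w).card = w.sum := by
  induction w with
  | nil => rfl
  | cons a w ih =>
    rw [YoungDiagram.cellsOfRowLens, Finset.card_union_of_disjoint]
    · simp [ih]
    · rw [Finset.disjoint_left]
      rintro ⟨i, j⟩ h h'
      simp at h h'
      omega

theorem card_cells {d : ℕ} (lam : Nat.Partition d) : (diagram lam).cells.card = d :=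
  (card_cellsOfRowLens (rows lam)).trans (sum_rows lam)

/-- A Young tableau of shape `lam`: a bijective filling of the cells by `d` labels. -/
abbrev Tableau {d : ℕ} (lam : Nat.Partition d) : Type :=
  Fin d ≃ (diagram lam).cells

/-- A fixed tableau of each shape; up to isomorphism the Specht module does not depend on it. -/
def tableau {d : ℕ} (lam : Nat.Partition d) : Tableau lam :=
  ((diagram lam).cells.equivFinOfCardEq (card_cells lam)).symm

open scoped Classical in
/-- The row symmetrizer: the sum of all permutations preserving every row of the tableau. -/
def rowSymmetrizer {d : ℕ} {lam : Nat.Partition d} (T : Tableau lam) :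
    MonoidAlgebra ℚ (Equiv.Perm (Fin d)) :=
  ∑ p : Equiv.Perm (Fin d) with ∀ x, (T (p x)).1.1 = (T x).1.1, MonoidAlgebra.single p 1

open scoped Classical in
/-- The column antisymmetrizer: the signed sum of all permutations preserving every column of
the tableau. -/
def colAntisymmetrizer {d : ℕ} {lam : Nat.Partition d} (T : Tableau lam) :
    MonoidAlgebra ℚ (Equiv.Perm (Fin d)) :=
  ∑ q : Equiv.Perm (Fin d) with ∀ x, (T (q x)).1.2 = (T x).1.2,
    MonoidAlgebra.single q ((Equiv.Perm.sign q : ℤ) : ℚ)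

/-- The Young symmetrizer of a tableau. -/
def youngSymmetrizer {d : ℕ} {lam : Nat.Partition d} (T : Tableau lam) :
    MonoidAlgebra ℚ (Equiv.Perm (Fin d)) :=
  rowSymmetrizer T * colAntisymmetrizer T

/-- The Specht module `V_λ`, i.e. the irreducible module of `S_d` associated with `lam`: the left
ideal of the group algebra generated by the Young symmetrizer. -/
def spechtModule {d : ℕ} (lam : Nat.Partition d) :
    Submodule (MonoidAlgebra ℚ (Equiv.Perm (Fin d))) (MonoidAlgebra ℚ (Equiv.Perm (Fin d))) :=
  Submodule.span _ {youngSymmetrizer (tableau lam)}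

/-- The irreducible representation of `S_d` on the Specht module, by left multiplication. -/
def spechtRep {d : ℕ} (lam : Nat.Partition d) :
    Representation ℚ (Equiv.Perm (Fin d)) (spechtModule lam) :=
  Representation.ofModule' (spechtModule lam)

theorem exists_perm_of_type {d : ℕ} (mu : Nat.Partition d) :
    ∃ σ : Equiv.Perm (Fin d), σ.partition.parts = mu.parts := by
  have hle : ∀ a ∈ mu.parts.filter (fun a => ¬ 2 ≤ a), a = 1 := by
    intro a ha
    rw [Multiset.mem_filter] at ha
    have := mu.parts_pos ha.1
    omega
  have hadd := Multiset.filter_add_not (fun a => 2 ≤ a) mu.parts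
  have hone := Multiset.eq_replicate_card.mpr hle
  have hsum : (mu.parts.filter (fun a => 2 ≤ a)).sum
      + (mu.parts.filter (fun a => ¬ 2 ≤ a)).card = d := by
    have h := congrArg Multiset.sum hadd
    rw [Multiset.sum_add, mu.parts_sum, hone] at h
    simpa using h
  obtain ⟨σ, hσ⟩ := (Equiv.Perm.exists_with_cycleType_iff (Fin d)
    (m := mu.parts.filter (fun a => 2 ≤ a))).mpr
    ⟨by rw [Fintype.card_fin]; omega, fun a ha => (Multiset.mem_filter.mp ha).2⟩
  refine ⟨σ, ?_⟩
  rw [Equiv.Perm.parts_partition, ← Equiv.Perm.sum_cycleType, hσ, Fintype.card_fin,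
    show d - (mu.parts.filter (fun a => 2 ≤ a)).sum
      = (mu.parts.filter (fun a => ¬ 2 ≤ a)).card by omega, ← hone, hadd]

/-- A permutation of cycle type `mu`, fixed points being counted as parts equal to `1`. -/
def permOfType {d : ℕ} (mu : Nat.Partition d) : Equiv.Perm (Fin d) :=
  (exists_perm_of_type mu).choose

/-- The irreducible character `χ^λ_μ`: the character of the irreducible representation associated
with `lam`, on the conjugacy class of permutations of cycle type `mu`. -/
def chi {d : ℕ} (lam mu : Nat.Partition d) : ℚ :=
  (spechtRep lam).character (permOfType mu)

/-! ### Double Hurwitz numbers with completed cycles -/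

/-- The shifted symmetric power sum
`p_k(λ) = ∑_{i ≥ 1} ((λ_i - i + 1/2)^k - (-i + 1/2)^k)`; the terms with `i > ℓ(λ)` vanish, and the
index `i` below is shifted by one. -/
def shiftedPowerSum {d : ℕ} (k : ℕ) (lam : Nat.Partition d) : ℚ :=
  ∑ i : Fin (rows lam).length,
    ((((rows lam).get i : ℚ) - ((i : ℚ) + 1) + 1 / 2) ^ k - (-((i : ℚ) + 1) + 1 / 2) ^ k)

/-- The number `s` of completed cycles, determined by `r s = 2g - 2 + ℓ(α) + ℓ(β)`. -/
def numCycles {d : ℕ} (g r : ℕ) (alpha beta : Nat.Partition d) : ℕ :=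
  (2 * g + alpha.parts.card + beta.parts.card - 2) / r

/-- The double Hurwitz number `H^{g,(r)}_{α,β}` with completed `(r+1)`-cycles (for `α`, `β` and `g`
such that `r` divides `2g - 2 + ℓ(α) + ℓ(β)`). -/
def doubleHurwitz {d : ℕ} (g r : ℕ) (alpha beta : Nat.Partition d) : ℚ :=
  1 / ((alpha.parts.prod : ℚ) * (beta.parts.prod : ℚ)) *
    ∑ lam : Nat.Partition d, chi lam alpha *
      (shiftedPowerSum (r + 1) lam / ((r + 1).factorial : ℚ)) ^ numCycles g r alpha beta *
        chi lam beta

/-! ### Combinatorial Hodge integrals -/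

/-- The partition of `β₁ + … + β_n` with parts `β₁, …, β_n`. -/
def ofTuple {n : ℕ} (beta : Fin n → ℕ) : Nat.Partition (∑ i, beta i) :=
  Nat.Partition.ofSums _ (Finset.univ.val.map beta) rfl

/-- `P` is the polynomial `d H^{g,(2)}_{(d),β} / s!` in the parts `β₁, …, β_n`: it takes this value
at all `n`-tuples of positive integers, where `d = β₁ + … + β_n`. -/
def IsHurwitzPolynomial (g n : ℕ) (P : MvPolynomial (Fin n) ℚ) : Prop :=
  ∀ beta : Fin n → ℕ, (∀ i, 0 < beta i) →
    MvPolynomial.eval (fun i => (beta i : ℚ)) P =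
      ((∑ i, beta i : ℕ) : ℚ) *
        doubleHurwitz g 2 (Nat.Partition.indiscrete (∑ i, beta i)) (ofTuple beta) /
          ((numCycles g 2 (Nat.Partition.indiscrete (∑ i, beta i)) (ofTuple beta)).factorial : ℚ)

open scoped Classical in
/-- The polynomial `d H^{g,(2)}_{(d),β} / s!` in `β₁, …, β_n` (zero if there is none). -/
def hurwitzPolynomial (g n : ℕ) : MvPolynomial (Fin n) ℚ :=
  if h : ∃ P, IsHurwitzPolynomial g n P then h.choose else 0

open scoped Classical in
/-- The combinatorial Hodge integral `⟨⟨τ_{b₁} … τ_{b_n} Λ_{2k}⟩⟩_g`, that is `(-1)^k` times the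
coefficient of `β₁^{b₁} … β_n^{b_n}` in `d H^{g,(2)}_{(d),β} / s!`. It vanishes by convention if some
`b_i` is negative, and unless `b₁ + … + b_n + 2k = 3g + (n-1)/2`. -/
def hodgeIntegral {n : ℕ} (g k : ℕ) (b : Fin n → ℤ) : ℚ :=
  if (∀ i, 0 ≤ b i) ∧ (∑ i, (b i : ℚ)) + 2 * k = 3 * g + ((n : ℚ) - 1) / 2 then
    (-1) ^ k * (hurwitzPolynomial g n).coeff (Finsupp.equivFunOnFinite.symm fun i => (b i).toNat)
  else 0

end CompletedHurwitz

end

open CompletedHurwitz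

/-
The product of the row symmetrizer and the column antisymmetrizer of a hook has traces that are, up
to a factor, the coefficients of `det (1 - X P_σ) / (1 - X)`; at `X = 1` this polynomial is `d` if
`σ` is a `d`-cycle and `0` otherwise. The elements attached to hooks annihilate every Specht module
of a shape that is not a hook, hence `χ^λ_{(d)}` is `(-1)^k` if `λ` is the hook with leg length `k`,
and `0` if `λ` is not a hook.

On that hook `p₃ / 3! = d / 2 * ((k - (d - 1) / 2) ^ 2 + d ^ 2 / 12)`, so the sum over `λ` is a
combination of even moments of the centred leg length. Their generating series is
`∏ 2 sinh (β_i u / 2) / (2 sinh (u / 2)) = u ^ (n - 1) * ∏ β_i * ∏ 𝒮(β_i u) / 𝒮(u)`,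
where `𝒮(u) = 2 sinh (u / 2) / u`, and `P_{g,n}` is `(∑ β_i) ^ s` times a polynomial. Its part of
lowest degree is a constant times `(∑ β_i) ^ s`, so `⟨⟨τ_{b_1} ⋯ τ_{b_n} Λ_{2g}⟩⟩` is `1 / ∏ b_i!`
times a constant depending only on `g` and `n`, and both equations reduce to the ratio of the
constants for `n + 2` and `n`.
-/

noncomputable section

namespace CompletedHurwitz

open Equiv Finset

section GroupAlgebra

open MonoidAlgebra

variable {G k : Type*} [Group G]

theorem mul_mul_eq_zero_of_single [CommSemiring k] {a b : MonoidAlgebra k G}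
    (h : ∀ u : G, a * single u 1 * b = 0) (x : MonoidAlgebra k G) : a * x * b = 0 := by
  induction x using MonoidAlgebra.induction_linear with
  | zero => simp
  | add x y hx hy => rw [mul_add, add_mul, hx, hy, add_zero]
  | single u c =>
    have hc : (single u c : MonoidAlgebra k G) = c • single u 1 := by
      rw [smul_single, smul_eq_mul, mul_one]
    rw [hc, mul_smul_comm, smul_mul_assoc, h, smul_zero]

variable [Fintype G]

section CommSemiring

variable [CommSemiring k] (χ : G →* k)

open scoped Classical in
/-- The sum of the elements of `A` in the group algebra, weighted by the linear character `χ`. -/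
def charSum (A : Set G) : MonoidAlgebra k G :=
  ∑ g : G with g ∈ A, single g (χ g)

theorem charSum_mul_charSum_of_bijOn {A B C : Set G}
    (h : Set.BijOn (fun p : G × G => p.1 * p.2) (A ×ˢ B) C) :
    charSum χ A * charSum χ B = charSum χ C := by
  classical
  rw [charSum, charSum, sum_mul_sum, ← sum_product', charSum]
  refine sum_nbij (fun p => p.1 * p.2) (fun p hp => ?_) ?_ ?_ fun p _ => ?_
  · simpa using h.mapsTo (by simpa using hp)
  · simpa [Set.InjOn] using h.injOn
  · simpa [Set.SurjOn] using h.surjOn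
  · rw [single_mul_single, map_mul]

theorem charSum_singleton (g : G) : charSum χ {g} = single g (χ g) := by
  rw [charSum, sum_filter]
  exact (Fintype.sum_eq_single g fun x hx => if_neg hx).trans (if_pos rfl)

theorem single_mul_charSum {H : Subgroup G} {g : G} (hg : g ∈ H) :
    single g (χ g) * charSum χ (H : Set G) = charSum χ (H : Set G) := by
  rw [← charSum_singleton]
  refine charSum_mul_charSum_of_bijOn χ ⟨?_, ?_, fun x hx => ⟨(g, g⁻¹ * x), ?_, by simp⟩⟩
  · rintro ⟨x, y⟩ ⟨rfl, hy⟩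
    exact mul_mem hg hy
  · rintro ⟨x, y⟩ ⟨rfl, -⟩ ⟨x', y'⟩ ⟨rfl, -⟩ h
    simpa using h
  · exact ⟨rfl, mul_mem (inv_mem hg) hx⟩

theorem charSum_mul_single {H : Subgroup G} {g : G} (hg : g ∈ H) :
    charSum χ (H : Set G) * single g (χ g) = charSum χ (H : Set G) := by
  rw [← charSum_singleton]
  refine charSum_mul_charSum_of_bijOn χ ⟨?_, ?_, fun x hx => ⟨(x * g⁻¹, g), ?_, by simp⟩⟩
  · rintro ⟨x, y⟩ ⟨hx, rfl⟩
    exact mul_mem hx hg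
  · rintro ⟨x, y⟩ ⟨-, rfl⟩ ⟨x', y'⟩ ⟨-, rfl⟩ h
    simpa using h
  · exact ⟨mul_mem hx (inv_mem hg), rfl⟩

theorem charSum_mul_charSum_of_le {H K : Subgroup G} (h : H ≤ K) :
    charSum χ (K : Set G) * charSum χ (H : Set G) = Nat.card H • charSum χ (K : Set G) := by
  classical
  nth_rewrite 2 [charSum]
  rw [mul_sum]
  refine (sum_eq_card_nsmul fun g hg => charSum_mul_single χ (h (mem_filter.1 hg).2)).trans ?_
  rw [← Fintype.card_subtype, ← Nat.card_eq_fintype_card]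

theorem charSum_mul_charSum_of_ge {H K : Subgroup G} (h : H ≤ K) :
    charSum χ (H : Set G) * charSum χ (K : Set G) = Nat.card H • charSum χ (K : Set G) := by
  classical
  nth_rewrite 1 [charSum]
  rw [sum_mul]
  refine (sum_eq_card_nsmul fun g hg => single_mul_charSum χ (h (mem_filter.1 hg).2)).trans ?_
  rw [← Fintype.card_subtype, ← Nat.card_eq_fintype_card]

theorem conj_charSum (u : G) (A : Set G) :
    single u 1 * charSum χ A * single u⁻¹ 1 = charSum χ (MulAut.conj u '' A) := by
  classical
  rw [charSum, mul_sum, sum_mul, charSum]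
  refine sum_nbij (MulAut.conj u) (fun g hg => ?_) (MulAut.conj u).injective.injOn ?_ fun g _ => ?_
  · simpa using hg
  · rintro _ hg
    simpa using hg
  · have hχ : χ (u * g * u⁻¹) = χ g := by
      rw [map_mul, map_mul, mul_right_comm, ← map_mul, mul_inv_cancel, map_one, one_mul]
    simp [single_mul_single, hχ]

theorem commute_charSum (ψ : G →* k) {A B : Set G} (h : ∀ a ∈ A, ∀ b ∈ B, Commute a b) :
    Commute (charSum χ A) (charSum ψ B) := by
  classical
  exact Commute.sum_left _ _ _ fun a ha => Commute.sum_right _ _ _ fun b hb =>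
    single_commute_single (h a (mem_filter.1 ha).2 b (mem_filter.1 hb).2) (Commute.all _ _)

end CommSemiring

theorem charSum_mul_single_mul_charSum_eq_zero [CommRing k] [IsDomain k] (χ ψ : G →* k)
    {H K : Subgroup G} {u t : G} (ht : t ∈ K) (hut : u * t * u⁻¹ ∈ H)
    (hne : χ (u * t * u⁻¹) ≠ ψ t) :
    charSum χ (H : Set G) * single u 1 * charSum ψ (K : Set G) = 0 := by
  set z := charSum χ (H : Set G) * single u 1 * charSum ψ (K : Set G) with hz
  set w := charSum χ (H : Set G) * single (u * t) 1 * charSum ψ (K : Set G) with hw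
  have hχ : χ (u * t * u⁻¹) • w = z := by
    conv_rhs => rw [hz, ← charSum_mul_single χ hut, mul_assoc (charSum χ (H : Set G)),
      single_mul_single, inv_mul_cancel_right, mul_one]
    rw [hw, ← smul_mul_assoc, ← mul_smul_comm, smul_single, smul_eq_mul, mul_one]
  have hψ : ψ t • w = z := by
    conv_rhs => rw [hz, ← single_mul_charSum ψ ht, ← mul_assoc, mul_assoc (charSum χ (H : Set G)),
      single_mul_single, one_mul]
    rw [hw, ← smul_mul_assoc, ← mul_smul_comm, smul_single, smul_eq_mul, mul_one]
  have hw0 : (χ (u * t * u⁻¹) - ψ t) • w = 0 := by rw [sub_smul, hχ, hψ, sub_self]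
  rw [← hχ, (smul_eq_zero.1 hw0).resolve_left (sub_ne_zero.2 hne), smul_zero]

end GroupAlgebra

theorem trace_eq_trace_comp_of_retraction {k V W : Type*} [Field k] [AddCommGroup V] [Module k V]
    [FiniteDimensional k V] [AddCommGroup W] [Module k W] [FiniteDimensional k W]
    {i : W →ₗ[k] V} {p : V →ₗ[k] W} (hpi : p ∘ₗ i = LinearMap.id) {e : W →ₗ[k] W}
    {f : V →ₗ[k] V} (hef : i ∘ₗ e = f ∘ₗ i) :
    LinearMap.trace k W e = LinearMap.trace k V (f ∘ₗ i ∘ₗ p) :=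
  calc LinearMap.trace k W e = LinearMap.trace k W (p ∘ₗ f ∘ₗ i) := by
        rw [← hef, ← LinearMap.comp_assoc, hpi, LinearMap.id_comp]
    _ = LinearMap.trace k V (f ∘ₗ i ∘ₗ p) := by
        rw [LinearMap.trace_comp_comm', LinearMap.comp_assoc]

section Character

open MonoidAlgebra

variable {G k : Type*} [Group G]

theorem asAlgebraHom_span_eq_zero [Field k] {c E : MonoidAlgebra k G} (hE : ∀ x, E * x * c = 0) :
    (Representation.ofModule' (k := k) (G := G)
      (Submodule.span (MonoidAlgebra k G) {c})).asAlgebraHom E = 0 := by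
  rw [Representation.ofModule', Representation.asAlgebraHom, Equiv.apply_symm_apply]
  ext1 ⟨v, hv⟩
  obtain ⟨x, rfl⟩ := Submodule.mem_span_singleton.1 hv
  exact Subtype.ext ((mul_assoc E x c).symm.trans (hE x))

variable [Fintype G]

section ClassTrace

variable [CommSemiring k]

/-- The sum of the coefficients of the conjugates `h⁻¹ u h` over all `h`, so that every conjugate
of `u` is counted as often as the centralizer of `u` has elements. -/
def classTrace (u : G) : MonoidAlgebra k G →ₗ[k] k where
  toFun x := ∑ h : G, x.coeff (h⁻¹ * u * h)
  map_add' x y := by simp only [coeff_add, Finsupp.add_apply, sum_add_distrib]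
  map_smul' c x := by simp only [coeff_smul, Finsupp.smul_apply, smul_sum, RingHom.id_apply]

theorem classTrace_apply (u : G) (x : MonoidAlgebra k G) :
    classTrace u x = ∑ h : G, x.coeff (h⁻¹ * u * h) := rfl

theorem classTrace_single_mul (u g : G) (x : MonoidAlgebra k G) :
    classTrace u (single g 1 * x) = classTrace u (x * single g 1) := by
  rw [classTrace_apply, classTrace_apply]
  refine Fintype.sum_equiv (Equiv.mulRight g) _ _ fun h => ?_
  rw [coeff_single_mul_apply, coeff_mul_single_apply]
  simp [mul_assoc]

theorem classTrace_conj (u g : G) (x : MonoidAlgebra k G) :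
    classTrace u (single g 1 * x * single g⁻¹ 1) = classTrace u x := by
  rw [mul_assoc, classTrace_single_mul, mul_assoc, single_mul_single, inv_mul_cancel, mul_one,
    ← MonoidAlgebra.one_def, mul_one]

theorem classTrace_charSum_image_conj (χ ψ : G →* k) (u g : G) (A B : Set G) :
    classTrace u (charSum χ (MulAut.conj g '' A) * charSum ψ (MulAut.conj g '' B)) =
      classTrace u (charSum χ A * charSum ψ B) := by
  have hcancel : (single g⁻¹ 1 * single g 1 : MonoidAlgebra k G) = 1 := by
    rw [single_mul_single, inv_mul_cancel, mul_one, MonoidAlgebra.one_def]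
  calc _ = classTrace u (single g 1 * (charSum χ A * (single g⁻¹ 1 * single g 1) *
        charSum ψ B) * single g⁻¹ 1) := by
        rw [← conj_charSum, ← conj_charSum]
        simp only [mul_assoc]
    _ = _ := by rw [hcancel, mul_one, classTrace_conj]

end ClassTrace

theorem trace_mulLeft_comp_mulRight [CommRing k] (g : G) (c : MonoidAlgebra k G) :
    LinearMap.trace k (MonoidAlgebra k G)
      (LinearMap.mulLeft k (single g 1) ∘ₗ LinearMap.mulRight k c) = classTrace g⁻¹ c := by
  classical
  rw [LinearMap.trace_eq_matrix_trace k (MonoidAlgebra.basis G k), Matrix.trace, classTrace_apply]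
  refine sum_congr rfl fun h _ => ?_
  rw [Matrix.diag_apply, LinearMap.toMatrix_apply, MonoidAlgebra.basis_apply]
  change ((single g 1 : MonoidAlgebra k G) * (single h 1 * c)).coeff h = _
  rw [coeff_single_mul_apply, coeff_single_mul_apply, one_mul, one_mul, mul_assoc]

variable [Field k]

theorem character_span_of_mul_self {c : MonoidAlgebra k G} {n : k} (hn : n ≠ 0)
    (h : c * c = n • c) (g : G) :
    (Representation.ofModule' (k := k) (G := G)
      (Submodule.span (MonoidAlgebra k G) {c})).character g = n⁻¹ * classTrace g⁻¹ c := by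
  let V := Submodule.span (MonoidAlgebra k G) {c}
  let i : V →ₗ[k] MonoidAlgebra k G := V.subtype.restrictScalars k
  let p : MonoidAlgebra k G →ₗ[k] V := LinearMap.codRestrict (V.restrictScalars k)
    (n⁻¹ • LinearMap.mulRight k c) fun x => Submodule.mem_span_singleton.2 ⟨n⁻¹ • x, by simp⟩
  have hip : i ∘ₗ p = n⁻¹ • LinearMap.mulRight k c := rfl
  have hpi : p ∘ₗ i = LinearMap.id := by
    ext1 ⟨v, hv⟩
    obtain ⟨x, rfl⟩ := Submodule.mem_span_singleton.1 hv
    refine Subtype.ext ?_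
    change n⁻¹ • (x * c * c) = x * c
    rw [mul_assoc, h, mul_smul_comm, smul_smul, inv_mul_cancel₀ hn, one_smul]
  have hg : i ∘ₗ Representation.ofModule' (k := k) V g = LinearMap.mulLeft k (single g 1) ∘ₗ i :=
    rfl
  rw [Representation.character, trace_eq_trace_comp_of_retraction hpi hg, hip,
    LinearMap.comp_smul, map_smul, trace_mulLeft_comp_mulRight, smul_eq_mul]

variable {V : Type*} [AddCommGroup V] [Module k V] (ρ : Representation k G V)

theorem trace_asAlgebraHom (E : MonoidAlgebra k G) :
    LinearMap.trace k V (ρ.asAlgebraHom E) = ∑ g, E.coeff g * ρ.character g := by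
  induction E using MonoidAlgebra.induction_linear with
  | zero => simp
  | add x y hx hy =>
    simp only [map_add, hx, hy, coeff_add, Finsupp.add_apply, add_mul, sum_add_distrib]
  | single u c => classical simp [Finsupp.single_apply, Representation.character]

theorem sum_classTrace_mul_character (E : MonoidAlgebra k G) :
    ∑ u, classTrace u E * ρ.character u =
      Fintype.card G * LinearMap.trace k V (ρ.asAlgebraHom E) := by
  have hconj (h : G) : ∑ u, E.coeff (h⁻¹ * u * h) * ρ.character u =
      LinearMap.trace k V (ρ.asAlgebraHom E) := by
    rw [trace_asAlgebraHom]
    refine Fintype.sum_equiv (MulAut.conj h⁻¹).toEquiv _ _ fun u => ?_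
    simp only [MulEquiv.toEquiv_eq_coe, EquivLike.coe_coe, MulAut.conj_apply, inv_inv]
    rw [← ρ.char_conj u h⁻¹, inv_inv]
  simp_rw [classTrace_apply, sum_mul]
  rw [sum_comm, sum_congr rfl fun h _ => hconj h, sum_const, card_univ, nsmul_eq_mul]

end Character

section SymmetricGroup

open scoped Pointwise

open MonoidAlgebra

/-- The sign character of a symmetric group with rational values. -/
def signChar (α : Type*) [Fintype α] [DecidableEq α] : Perm α →* ℚ :=
  (Int.castRingHom ℚ).toMonoidHom.comp ((Units.coeHom ℤ).comp Perm.sign)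

variable {α : Type*}

/-- The subgroup of the permutations that move only elements of `X`. -/
def permsOn (X : Finset α) : Subgroup (Perm α) :=
  fixingSubgroup (Perm α) ((X : Set α)ᶜ)

theorem mem_permsOn {X : Finset α} {p : Perm α} : p ∈ permsOn X ↔ ∀ x ∉ X, p x = x := by
  simp [permsOn, mem_fixingSubgroup_iff]

theorem permsOn_mono {X Y : Finset α} (h : X ⊆ Y) : permsOn X ≤ permsOn Y := fun _ hp =>
  mem_permsOn.2 fun x hx => mem_permsOn.1 hp x fun hx' => hx (h hx')

theorem apply_mem_of_mem_permsOn {X : Finset α} {p : Perm α} (hp : p ∈ permsOn X) {x : α}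
    (hx : x ∈ X) : p x ∈ X := by
  by_contra h
  have hpx : p (p x) = p x := mem_permsOn.1 hp _ h
  exact h (by rwa [p.injective hpx])

theorem image_conj_permsOn (u : Perm α) (X : Finset α) :
    MulAut.conj u '' (permsOn X : Set (Perm α)) = permsOn (X.map u.toEmbedding) := by
  have h : (u • (X : Set α)ᶜ : Set α) = ((X.map u.toEmbedding : Finset α) : Set α)ᶜ := by
    rw [Set.smul_set_compl, coe_map]
    rfl
  exact congrArg SetLike.coe (SubMulAction.fixingSubgroup_map_conj_eq h)

theorem commute_of_mem_permsOn {X Y : Finset α} (h : Disjoint X Y) {p q : Perm α}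
    (hp : p ∈ permsOn X) (hq : q ∈ permsOn Y) : Commute p q := by
  refine Perm.Disjoint.commute fun x => ?_
  by_cases hx : x ∈ X
  · exact Or.inr (mem_permsOn.1 hq x (disjoint_left.1 h hx))
  · exact Or.inl (mem_permsOn.1 hp x hx)

variable [DecidableEq α]

theorem swap_mem_permsOn {X : Finset α} {x y : α} (hx : x ∈ X) (hy : y ∈ X) :
    swap x y ∈ permsOn X :=
  mem_permsOn.2 fun _ hz => swap_apply_of_ne_of_ne (fun h => hz (h ▸ hx)) (fun h => hz (h ▸ hy))

theorem card_permsOn {α : Type*} (X : Finset α) : Nat.card (permsOn X) = X.card.factorial := by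
  classical
  rw [← Fintype.card_coe X, ← Fintype.card_perm, ← Nat.card_eq_fintype_card]
  refine Nat.card_congr (Equiv.trans ?_ (Perm.subtypeEquivSubtypePerm (· ∈ X)).symm)
  exact Equiv.subtypeEquivRight fun p => mem_permsOn

theorem bijOn_swap_mul {X : Finset α} {y : α} (hy : y ∉ X) :
    Set.BijOn (fun p : Perm α × Perm α => p.1 * p.2)
      (((fun x => swap x y) '' (insert y X : Finset α)) ×ˢ (permsOn X : Set (Perm α)))
      (permsOn (insert y X) : Set (Perm α)) := by
  have hfix {p : Perm α} (hp : p ∈ permsOn X) : p y = y := mem_permsOn.1 hp y hy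
  refine ⟨?_, ?_, fun p hp => ⟨(swap (p y) y, swap (p y) y * p),
    ⟨⟨p y, apply_mem_of_mem_permsOn hp (mem_insert_self _ _), rfl⟩, mem_permsOn.2 fun z hz => ?_⟩,
    swap_mul_self_mul _ _ _⟩⟩
  · rintro ⟨_, q⟩ ⟨⟨x, hx, rfl⟩, hq⟩
    exact mul_mem (swap_mem_permsOn hx (mem_insert_self _ _)) (permsOn_mono (subset_insert _ _) hq)
  · rintro ⟨_, q⟩ ⟨⟨x, -, rfl⟩, hq⟩ ⟨_, q'⟩ ⟨⟨x', -, rfl⟩, hq'⟩ h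
    have hxx' : x = x' := by
      simpa [hfix hq, hfix hq'] using congrArg (fun p : Perm α => p y) h
    simpa [hxx'] using h
  · by_cases hzy : z = y
    · simp [hzy]
    · have hpz : p z = z := mem_permsOn.1 hp z (by simp [hzy, hz])
      have hpy : z ≠ p y := fun h => hzy (p.injective (hpz.trans h))
      rw [Perm.mul_apply, hpz, swap_apply_of_ne_of_ne hpy hzy]

theorem bijOn_mul_swap {X : Finset α} {y : α} (hy : y ∉ X) :
    Set.BijOn (fun p : Perm α × Perm α => p.1 * p.2)
      ((permsOn X : Set (Perm α)) ×ˢ ((fun x => swap x y) '' (insert y X : Finset α)))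
      (permsOn (insert y X) : Set (Perm α)) := by
  refine ⟨?_, ?_, fun p hp => ?_⟩
  · rintro ⟨q, _⟩ ⟨hq, ⟨x, hx, rfl⟩⟩
    exact mul_mem (permsOn_mono (subset_insert _ _) hq) (swap_mem_permsOn hx (mem_insert_self _ _))
  · rintro ⟨q, _⟩ ⟨hq, ⟨x, hx, rfl⟩⟩ ⟨q', _⟩ ⟨hq', ⟨x', hx', rfl⟩⟩ h
    have hinv : swap x y * q⁻¹ = swap x' y * q'⁻¹ := by
      simpa using congrArg (·⁻¹) h
    have hpair : (swap x y, q⁻¹) = (swap x' y, q'⁻¹) := (bijOn_swap_mul hy).injOn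
      ⟨⟨x, hx, rfl⟩, inv_mem hq⟩ ⟨⟨x', hx', rfl⟩, inv_mem hq'⟩ hinv
    simpa [and_comm] using hpair
  · obtain ⟨⟨_, q⟩, ⟨⟨x, hx, rfl⟩, hq⟩, h⟩ := (bijOn_swap_mul hy).surjOn (inv_mem hp)
    exact ⟨(q⁻¹, swap x y), ⟨inv_mem hq, x, hx, rfl⟩, inv_injective (by simpa using h)⟩

variable [Fintype α]

theorem signChar_swap {x y : α} (h : x ≠ y) : signChar α (swap x y) = -1 := by
  simp [signChar, Perm.sign_swap h]

theorem charSum_image_swap {k : Type*} [CommSemiring k] (χ : Perm α →* k) {X : Finset α} {y : α}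
    (hy : y ∉ X) :
    charSum χ ((fun x => swap x y) '' (insert y X : Finset α)) =
      1 + ∑ x ∈ X, single (swap x y) (χ (swap x y)) := by
  classical
  have hinj : Function.Injective fun x => swap x y := fun a b h => by
    simpa using congrArg (fun p : Perm α => p y) h
  have himage : ({g | g ∈ (fun x => swap x y) '' (insert y X : Finset α)} : Finset (Perm α)) =
      (insert y X).image fun x => swap x y := by
    ext g
    simp only [Set.mem_image, mem_coe, mem_filter_univ, mem_image]
  rw [charSum, himage, sum_image hinj.injOn, sum_insert hy, swap_self, ← Perm.one_def, map_one,
    MonoidAlgebra.one_def]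

/-- The sum of the permutations of `X` in the group algebra. -/
def symmetrizer (X : Finset α) : MonoidAlgebra ℚ (Perm α) :=
  charSum 1 (permsOn X : Set (Perm α))

/-- The sum of the permutations of `X` in the group algebra, weighted by their signs. -/
def antisymmetrizer (X : Finset α) : MonoidAlgebra ℚ (Perm α) :=
  charSum (signChar α) (permsOn X : Set (Perm α))

theorem symmetrizer_insert {X : Finset α} {y : α} (hy : y ∉ X) :
    symmetrizer (insert y X) = symmetrizer X * (1 + ∑ x ∈ X, single (swap x y) 1) := by
  rw [symmetrizer, ← charSum_mul_charSum_of_bijOn _ (bijOn_mul_swap hy), charSum_image_swap _ hy]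
  rfl

theorem antisymmetrizer_insert {X : Finset α} {y : α} (hy : y ∉ X) :
    antisymmetrizer (insert y X) = (1 - ∑ x ∈ X, single (swap x y) 1) * antisymmetrizer X := by
  rw [antisymmetrizer, ← charSum_mul_charSum_of_bijOn _ (bijOn_swap_mul hy),
    charSum_image_swap _ hy, sub_eq_add_neg, ← sum_neg_distrib]
  congr 2
  refine sum_congr rfl fun x hx => ?_
  rw [signChar_swap (ne_of_mem_of_not_mem hx hy), single_neg]

theorem classTrace_symmetrizer_mul_antisymmetrizer_map (u p : Perm α) (X Y : Finset α) :
    classTrace u (symmetrizer (X.map p.toEmbedding) * antisymmetrizer (Y.map p.toEmbedding)) =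
      classTrace u (symmetrizer X * antisymmetrizer Y) := by
  rw [symmetrizer, antisymmetrizer, ← image_conj_permsOn, ← image_conj_permsOn,
    classTrace_charSum_image_conj]
  rfl

end SymmetricGroup

section HookElement

open MonoidAlgebra

variable {α : Type*} [Fintype α] [DecidableEq α]

theorem symmetrizer_mul_single_swap {X : Finset α} {x y : α} (hx : x ∈ X) (hy : y ∈ X) :
    symmetrizer X * single (swap x y) 1 = symmetrizer X :=
  charSum_mul_single (1 : Perm α →* ℚ) (swap_mem_permsOn hx hy)

theorem symmetrizer_mul_symmetrizer {X Y : Finset α} (h : Y ⊆ X) :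
    symmetrizer X * symmetrizer Y = Y.card.factorial • symmetrizer X := by
  rw [symmetrizer, symmetrizer, charSum_mul_charSum_of_le _ (permsOn_mono h), card_permsOn]

theorem antisymmetrizer_mul_antisymmetrizer {X Y : Finset α} (h : Y ⊆ X) :
    antisymmetrizer Y * antisymmetrizer X = Y.card.factorial • antisymmetrizer X := by
  rw [antisymmetrizer, antisymmetrizer, charSum_mul_charSum_of_ge _ (permsOn_mono h), card_permsOn]

theorem commute_antisymmetrizer_symmetrizer {X Y : Finset α} (h : Disjoint X Y) :
    Commute (antisymmetrizer X) (symmetrizer Y) :=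
  commute_charSum _ _ fun _ hp _ hq => commute_of_mem_permsOn h hp hq

theorem commute_antisymmetrizer_single_swap {X : Finset α} {x y : α} (hx : x ∉ X) (hy : y ∉ X) :
    Commute (antisymmetrizer X) (single (swap x y) 1) := by
  have h : Disjoint X {x, y} := by simp [hx, hy]
  rw [← MonoidHom.one_apply (M := Perm α) (N := ℚ) (swap x y), ← charSum_singleton]
  refine commute_charSum _ _ fun p hp q hq => commute_of_mem_permsOn h hp ?_
  rw [Set.mem_singleton_iff.1 hq]
  exact swap_mem_permsOn (by simp) (by simp)

theorem symmetrizer_mul_single_mul_antisymmetrizer_eq_zero {X Y : Finset α} {u : Perm α} {x y : α}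
    (hxy : x ≠ y) (hx : x ∈ Y) (hy : y ∈ Y) (hux : u x ∈ X) (huy : u y ∈ X) :
    symmetrizer X * single u 1 * antisymmetrizer Y = 0 := by
  refine charSum_mul_single_mul_charSum_eq_zero _ _ (swap_mem_permsOn hx hy) ?_ ?_
  · rw [← swap_apply_apply]
    exact swap_mem_permsOn hux huy
  · rw [signChar_swap hxy, MonoidHom.one_apply]
    norm_num

theorem sum_symmetrizer_mul_antisymmetrizer_insert {X Y : Finset α} (h : Disjoint X Y) :
    ∑ x ∈ X, symmetrizer X * antisymmetrizer (insert x Y) +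
      ∑ y ∈ Y, symmetrizer (insert y X) * antisymmetrizer Y =
    (X.card + Y.card) • (symmetrizer X * antisymmetrizer Y) := by
  set a := symmetrizer X
  set b := antisymmetrizer Y
  have hX : ∀ x ∈ X, a * antisymmetrizer (insert x Y) =
      a * b - ∑ y ∈ Y, a * single (swap x y) 1 * b := fun x hx => by
    rw [antisymmetrizer_insert (disjoint_left.1 h hx), ← mul_assoc, mul_sub, mul_one, mul_sum,
      sub_mul, sum_mul]
    simp only [swap_comm x, b]
  have hY : ∀ y ∈ Y, symmetrizer (insert y X) * b =
      a * b + ∑ x ∈ X, a * single (swap x y) 1 * b := fun y hy => by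
    rw [symmetrizer_insert (disjoint_right.1 h hy), mul_add, mul_one, mul_sum, add_mul, sum_mul]
  rw [sum_congr rfl hX, sum_congr rfl hY, sum_sub_distrib, sum_add_distrib, sum_comm (s := X),
    sum_const, sum_const, add_smul]
  abel

section Square

variable {R C : Finset α} {o : α}

theorem hook_mul_swap_mul_antisymmetrizer (hR : o ∉ R) (hC : o ∉ C) (hRC : Disjoint R C) {r : α}
    (hr : r ∈ R) :
    symmetrizer (insert o R) * antisymmetrizer (insert o C) * single (swap r o) 1 *
        antisymmetrizer (insert o C) =
      C.card.factorial • (symmetrizer (insert o R) * antisymmetrizer (insert o C)) := by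
  set a := symmetrizer (insert o R)
  set b := antisymmetrizer (insert o C) with hb
  have hro : r ≠ o := ne_of_mem_of_not_mem hr hR
  have hzero : ∀ j ∈ C, a * single (swap j o) 1 * single (swap r o) 1 * b = 0 := fun j hj => by
    have hjo : j ≠ o := ne_of_mem_of_not_mem hj hC
    have hjr : j ≠ r := (ne_of_mem_of_not_mem hr (disjoint_right.1 hRC hj)).symm
    rw [mul_assoc a, single_mul_single, mul_one]
    refine symmetrizer_mul_single_mul_antisymmetrizer_eq_zero hjo (mem_insert_of_mem hj)
      (mem_insert_self _ _) ?_ ?_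
    · rw [Perm.mul_apply, swap_apply_of_ne_of_ne hjr hjo, swap_apply_left]
      exact mem_insert_self _ _
    · rw [Perm.mul_apply, swap_apply_right, swap_apply_of_ne_of_ne hjr.symm hro]
      exact mem_insert_of_mem hr
  calc a * b * single (swap r o) 1 * b
      = a * (1 - ∑ j ∈ C, single (swap j o) 1) * single (swap r o) 1 *
          (antisymmetrizer C * b) := by
        nth_rewrite 1 [hb]
        rw [antisymmetrizer_insert hC, ← mul_assoc a, mul_assoc (a * _),
          (commute_antisymmetrizer_single_swap (disjoint_left.1 hRC hr) hC).eq]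
        simp only [mul_assoc]
    _ = C.card.factorial • (a * single (swap r o) 1 * b -
          ∑ j ∈ C, a * single (swap j o) 1 * single (swap r o) 1 * b) := by
        rw [antisymmetrizer_mul_antisymmetrizer (subset_insert _ _), mul_smul_comm, mul_sub,
          mul_one, mul_sum, sub_mul, sub_mul, sum_mul, sum_mul]
    _ = C.card.factorial • (a * b) := by
        rw [sum_eq_zero hzero, sub_zero,
          symmetrizer_mul_single_swap (mem_insert_of_mem hr) (mem_insert_self _ _)]

theorem hook_mul_self (hR : o ∉ R) (hC : o ∉ C) (hRC : Disjoint R C) :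
    (symmetrizer (insert o R) * antisymmetrizer (insert o C)) *
      (symmetrizer (insert o R) * antisymmetrizer (insert o C)) =
    (R.card.factorial * C.card.factorial * (R.card + C.card + 1)) •
      (symmetrizer (insert o R) * antisymmetrizer (insert o C)) := by
  set a := symmetrizer (insert o R) with ha
  set b := antisymmetrizer (insert o C)
  have hcomm : b * symmetrizer R = symmetrizer R * b :=
    commute_antisymmetrizer_symmetrizer (disjoint_insert_left.2 ⟨hR, hRC.symm⟩)
  calc a * b * (a * b)
      = a * (b * symmetrizer R) * (1 + ∑ r ∈ R, single (swap r o) 1) * b := by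
        nth_rewrite 2 [ha]
        rw [symmetrizer_insert hR]
        simp only [mul_assoc]
    _ = R.card.factorial • (a * (b * b) + ∑ r ∈ R, a * b * single (swap r o) 1 * b) := by
        rw [hcomm, ← mul_assoc a, symmetrizer_mul_symmetrizer (subset_insert _ _), smul_mul_assoc,
          smul_mul_assoc, smul_mul_assoc, mul_add, mul_one, add_mul, mul_sum, sum_mul,
          mul_assoc a b b]
    _ = R.card.factorial • (C.card + 1).factorial • (a * b) +
          R.card.factorial • R.card • C.card.factorial • (a * b) := by
        rw [sum_congr rfl fun r hr => hook_mul_swap_mul_antisymmetrizer hR hC hRC hr, sum_const,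
          antisymmetrizer_mul_antisymmetrizer (Subset.refl _), card_insert_of_notMem hC,
          mul_smul_comm, smul_add]
    _ = _ := by
        rw [smul_smul, smul_smul, smul_smul, ← add_smul, Nat.factorial_succ]
        congr 1
        ring

end Square

/-- The Young symmetrizer of a hook-shaped tableau with corner `o`, where the rest of the first
column is filled with `Y` and the rest of the first row with the remaining elements. -/
def hookElement (o : α) (Y : Finset α) : MonoidAlgebra ℚ (Perm α) :=
  symmetrizer Yᶜ * antisymmetrizer (insert o Y)

theorem hookElement_mul_self {o : α} {Y : Finset α} (ho : o ∉ Y) :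
    hookElement o Y * hookElement o Y =
      ((Fintype.card α - Y.card - 1).factorial * Y.card.factorial * Fintype.card α : ℚ) •
        hookElement o Y := by
  have hins : insert o (insert o Y)ᶜ = Yᶜ := by
    rw [compl_insert, insert_erase (mem_compl.2 ho)]
  have hdisj : Disjoint (insert o Y)ᶜ Y := by
    rw [disjoint_compl_left_iff]
    exact subset_insert o Y
  have hcard : ((insert o Y)ᶜ : Finset α).card = Fintype.card α - Y.card - 1 := by
    rw [card_compl, card_insert_of_notMem ho, Nat.sub_sub]
  have hle : Y.card + 1 ≤ Fintype.card α := card_insert_of_notMem ho ▸ card_le_univ (insert o Y)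
  have h := hook_mul_self (R := (insert o Y)ᶜ) (by simp) ho hdisj
  rw [hins, hcard, show Fintype.card α - Y.card - 1 + Y.card + 1 = Fintype.card α by omega] at h
  rw [hookElement, h, ← Nat.cast_smul_eq_nsmul ℚ]
  push_cast
  rfl

end HookElement

section PermMatrix

open Matrix Polynomial

theorem eq_one_or_eq_of_isCycle {α : Type*} [Finite α] {σ q : Perm α} (hσ : σ.IsCycle)
    (h : ∀ i, q i = i ∨ q i = σ i) : q = 1 ∨ q = σ := by
  by_cases hq : ∃ i, σ i ≠ i ∧ q i ≠ i
  · obtain ⟨i, hi, hqi⟩ := hq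
    have hmove (m : ℕ) : q ((σ ^ m) i) = σ ((σ ^ m) i) := by
      induction m with
      | zero => exact (h i).resolve_left hqi
      | succ m ih =>
        refine (h _).resolve_left fun h' => hi ((σ ^ m).injective ?_)
        have hfix : σ ((σ ^ m) i) = (σ ^ m) i := by
          rw [pow_succ', Perm.mul_apply] at h'
          exact q.injective (h'.trans ih.symm)
        rw [← Perm.mul_apply, ← pow_succ, pow_succ', Perm.mul_apply, hfix]
    refine Or.inr (Perm.ext fun j => ?_)
    by_cases hj : σ j = j
    · simpa [hj] using h j
    · obtain ⟨m, rfl⟩ := hσ.exists_pow_eq hi hj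
      exact hmove m
  · push Not at hq
    refine Or.inl (Perm.ext fun i => ?_)
    by_cases hi : σ i = i
    · simpa [hi] using h i
    · exact hq i hi

variable {α : Type*} [DecidableEq α] {R : Type*} [CommRing R]

theorem permMatrix_add_permMatrix {σ τ : Perm α} (h : σ.Disjoint τ) :
    σ.permMatrix R + τ.permMatrix R = 1 + (σ * τ).permMatrix R := by
  ext i j
  rw [Matrix.add_apply, Matrix.add_apply]
  rcases h i with hi | hi
  · have hστ : (σ * τ) i = τ i := by
      rw [h.commute.eq, Perm.mul_apply, hi]
    simp only [PEquiv.toMatrix_apply, toPEquiv_apply, hi, hστ, Matrix.one_apply,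
      Option.mem_some_iff]
  · simp only [PEquiv.toMatrix_apply, toPEquiv_apply, hi, Perm.mul_apply,
      Matrix.one_apply, Option.mem_some_iff, add_comm]

variable [Fintype α]

theorem charpolyRev_permMatrix_eq_sum (u : Perm α) :
    (u.permMatrix R).charpolyRev = ∑ q : Perm α, ((Perm.sign q : ℤ) : R[X]) *
      ∏ i, ((if q i = i then 1 else 0) - if q i = u i then X else 0) := by
  rw [charpolyRev, ← det_transpose, det_apply']
  refine sum_congr rfl fun q _ => congrArg _ (prod_congr rfl fun i _ => ?_)
  simp only [transpose_apply, Matrix.sub_apply, Matrix.smul_apply, map_apply, Matrix.one_apply,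
    PEquiv.toMatrix_apply, toPEquiv_apply, Option.mem_some_iff, eq_comm (a := q i), smul_eq_mul,
    apply_ite C, map_one, map_zero, mul_ite, mul_one, mul_zero]

theorem charpolyRev_permMatrix_mul {σ τ : Perm α} (h : σ.Disjoint τ) :
    (σ.permMatrix R).charpolyRev * (τ.permMatrix R).charpolyRev =
      (1 - X) ^ Fintype.card α * ((σ * τ).permMatrix R).charpolyRev := by
  set A := (σ.permMatrix R).map C
  set B := (τ.permMatrix R).map C
  have hadd : A + B = 1 + ((σ * τ).permMatrix R).map C := by
    rw [← Matrix.map_add C (map_add C), permMatrix_add_permMatrix h, Matrix.map_add C (map_add C),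
      Matrix.map_one C (map_zero C) (map_one C)]
  have hmul : A * B = ((σ * τ).permMatrix R).map C := by
    rw [h.commute.eq, permMatrix_mul, Matrix.map_mul]
  rw [charpolyRev, charpolyRev, charpolyRev, ← det_mul, ← det_smul]
  congr 1
  calc (1 - (X : R[X]) • A) * (1 - (X : R[X]) • B)
      = 1 - (X : R[X]) • (A + B) + (X ^ 2 : R[X]) • (A * B) := by
        rw [sub_mul, one_mul, mul_sub, mul_one, smul_mul_smul_comm, smul_add, pow_two]
        abel
    _ = (1 - X : R[X]) • (1 - (X : R[X]) • ((σ * τ).permMatrix R).map C) := by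
        rw [hadd, hmul, sub_smul, one_smul, smul_add, smul_sub, smul_smul, ← pow_two]
        abel

theorem charpolyRev_permMatrix_one :
    ((1 : Perm α).permMatrix R).charpolyRev = (1 - X) ^ Fintype.card α := by
  rw [permMatrix_one, charpolyRev, Matrix.map_one C (map_zero C) (map_one C)]
  nth_rw 1 [← one_smul R[X] (1 : Matrix α α R[X])]
  rw [← sub_smul, det_smul, det_one, mul_one]

theorem prod_ite_fixed (σ : Perm α) (a b : R) :
    ∏ i, (if σ i = i then a else b) =
      a ^ (Fintype.card α - σ.support.card) * b ^ σ.support.card := by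
  rw [prod_ite, prod_const, prod_const, ← card_compl]
  congr 3
  ext i
  simp

theorem charpolyRev_permMatrix_of_isCycle {σ : Perm α} (hσ : σ.IsCycle) :
    (σ.permMatrix R).charpolyRev =
      (1 - X) ^ (Fintype.card α - σ.support.card) * (1 - X ^ σ.support.card) := by
  have hone : ∏ i, ((if (1 : Perm α) i = i then 1 else 0) -
      if (1 : Perm α) i = σ i then (X : R[X]) else 0) =
      (1 - X) ^ (Fintype.card α - σ.support.card) := by
    have hprod := prod_ite_fixed σ (1 - X : R[X]) 1
    rw [one_pow, mul_one] at hprod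
    rw [← hprod]
    refine prod_congr rfl fun i _ => ?_
    rw [Perm.one_apply, if_pos rfl]
    simp only [eq_comm (a := i)]
    split_ifs
    exacts [rfl, sub_zero 1]
  have hself : ∏ i, ((if σ i = i then 1 else 0) - if σ i = σ i then (X : R[X]) else 0) =
      (1 - X) ^ (Fintype.card α - σ.support.card) * (-X) ^ σ.support.card := by
    rw [← prod_ite_fixed]
    refine prod_congr rfl fun i _ => ?_
    rw [if_pos rfl]
    split_ifs
    exacts [rfl, zero_sub X]
  have hsign : ((Perm.sign σ : ℤ) : R[X]) * (-X) ^ σ.support.card = -X ^ σ.support.card := by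
    rw [hσ.sign, Units.val_neg, Units.val_pow_eq_pow_val, Units.val_neg, Units.val_one,
      Int.cast_neg, Int.cast_pow, Int.cast_neg, Int.cast_one, neg_mul, ← mul_pow, neg_one_mul,
      neg_neg]
  rw [charpolyRev_permMatrix_eq_sum, sum_eq_add_of_mem 1 σ (mem_univ _) (mem_univ _) hσ.ne_one.symm]
  · rw [hone, hself, mul_left_comm, hsign, Perm.sign_one, Units.val_one, Int.cast_one, one_mul,
      ← mul_one_add, ← sub_eq_add_neg]
  · rintro q - ⟨hq1, hqσ⟩
    obtain ⟨i, hi⟩ : ∃ i, ¬ (q i = i ∨ q i = σ i) := by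
      by_contra! h
      exact (eq_one_or_eq_of_isCycle hσ h).elim hq1 hqσ
    rw [not_or] at hi
    rw [prod_eq_zero (mem_univ i) (by rw [if_neg hi.1, if_neg hi.2, sub_zero]), mul_zero]

theorem one_sub_X_ne_zero [Nontrivial R] : (1 - X : R[X]) ≠ 0 := fun h => by
  simpa using congrArg (eval 0) h

variable [IsDomain R]

theorem charpolyRev_permMatrix_eq_prod_cycleType (u : Perm α) :
    (u.permMatrix R).charpolyRev = (1 - X) ^ (Fintype.card α - u.support.card) *
      (u.cycleType.map fun c => (1 - X ^ c : R[X])).prod := by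
  induction u using Perm.cycle_induction_on with
  | base_one => rw [charpolyRev_permMatrix_one]; simp
  | base_cycles σ hσ => rw [charpolyRev_permMatrix_of_isCycle hσ, hσ.cycleType]; simp
  | induction_disjoint σ τ h _ ihσ ihτ =>
    have hcard := h.card_support_mul
    have hle : (σ * τ).support.card ≤ Fintype.card α := card_le_univ _
    have hexp : Fintype.card α - σ.support.card + (Fintype.card α - τ.support.card) =
        Fintype.card α + (Fintype.card α - (σ * τ).support.card) := by lia
    refine mul_left_cancel₀ (pow_ne_zero (Fintype.card α) one_sub_X_ne_zero) ?_
    rw [← charpolyRev_permMatrix_mul h, ihσ, ihτ, h.cycleType_mul, Multiset.map_add,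
      Multiset.prod_add, mul_mul_mul_comm, ← pow_add, hexp, pow_add, mul_assoc]

theorem charpolyRev_permMatrix (u : Perm α) :
    (u.permMatrix R).charpolyRev = (u.partition.parts.map fun c => (1 - X ^ c : R[X])).prod := by
  rw [charpolyRev_permMatrix_eq_prod_cycleType, Perm.parts_partition, Multiset.map_add,
    Multiset.prod_add, mul_comm, Multiset.map_replicate, Multiset.prod_replicate, pow_one]

end PermMatrix

section HookTrace

open Matrix MonoidAlgebra

theorem exists_perm_map_eq {α : Type*} [Finite α] {Y I : Finset α} (h : Y.card = I.card) :
    ∃ p : Perm α, Y.map p.toEmbedding = I := by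
  classical
  let e : Y ≃ I := equivOfCardEq h
  refine ⟨e.extendSubtype, eq_of_subset_of_card_le (fun x hx => ?_) (by simp [h])⟩
  obtain ⟨y, hy, rfl⟩ := mem_map.1 hx
  exact e.extendSubtype_mem y hy

variable {α : Type*} [Fintype α] [DecidableEq α]

theorem antisymmetrizer_eq_sum (X : Finset α) :
    antisymmetrizer X =
      ∑ q : Perm X, single (Perm.ofSubtype q) ((Perm.sign q : ℤ) : ℚ) := by
  classical
  let e : Perm X ≃ {p : Perm α // p ∈ permsOn X} :=
    (Perm.subtypeEquivSubtypePerm (· ∈ X)).trans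
      (Equiv.subtypeEquivRight fun _ => mem_permsOn.symm)
  rw [antisymmetrizer, charSum, sum_subtype (p := (· ∈ permsOn X)) _ (by simp),
    ← e.sum_comp]
  refine sum_congr rfl fun q _ => congrArg (MonoidAlgebra.single (Perm.ofSubtype q)) ?_
  exact congrArg (fun z : ℤˣ => ((z : ℤ) : ℚ)) (Perm.sign_ofSubtype q)

theorem coeff_symmetrizer (X : Finset α) (p : Perm α) [Decidable (p ∈ permsOn X)] :
    (symmetrizer X).coeff p = if p ∈ permsOn X then 1 else 0 := by
  rw [symmetrizer, charSum, coeff_sum, Finsupp.finsetSum_apply]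
  simp [Finsupp.single_apply]

theorem coeff_symmetrizer_mul_antisymmetrizer (u : Perm α) (I : Finset α) :
    (symmetrizer Iᶜ * antisymmetrizer I).coeff u =
      ((u.permMatrix ℚ).submatrix ((↑) : I → α) (↑)).det := by
  classical
  rw [antisymmetrizer_eq_sum, mul_sum, coeff_sum, Finsupp.finsetSum_apply, ← det_transpose,
    det_apply']
  refine sum_congr rfl fun q _ => ?_
  have hmem : u * (Perm.ofSubtype q)⁻¹ ∈ permsOn Iᶜ ↔ ∀ i : I, u i = q i := by
    simp only [mem_permsOn, mem_compl, not_not]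
    refine ⟨fun h i => ?_, fun h x hx => ?_⟩
    · have hq := h (q i) (q i).2
      rwa [← map_inv, Perm.mul_apply, Perm.ofSubtype_apply_coe, ← Perm.mul_apply, inv_mul_cancel,
        Perm.one_apply] at hq
    · rw [← map_inv, Perm.mul_apply, Perm.ofSubtype_apply_of_mem _ hx, h, ← Perm.mul_apply,
        mul_inv_cancel, Perm.one_apply]
  rw [coeff_mul_single_apply, coeff_symmetrizer, if_congr hmem rfl rfl, mul_comm]
  simp only [transpose_apply, submatrix_apply, PEquiv.toMatrix_apply, toPEquiv_apply,
    Option.mem_some_iff, prod_ite_zero, prod_const_one, mem_univ, true_imp_iff]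

theorem sum_coeff_symmetrizer_mul_antisymmetrizer (u : Perm α) (k : ℕ) :
    ∑ I ∈ powersetCard k univ, (symmetrizer Iᶜ * antisymmetrizer I).coeff u =
      (-1) ^ k * (u.permMatrix ℚ).charpolyRev.coeff k := by
  have hneg : (u.permMatrix ℚ).charpolyRev =
      det (1 + (Polynomial.X : Polynomial ℚ) • (-(u.permMatrix ℚ)).map Polynomial.C) := by
    rw [charpolyRev, Matrix.map_neg _ (map_neg Polynomial.C), smul_neg, sub_eq_add_neg]
  rw [hneg, coeff_det_one_add_X_smul_eq_sum_minors, mul_sum]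
  refine sum_congr rfl fun I hI => ?_
  rw [coeff_symmetrizer_mul_antisymmetrizer, submatrix_neg, Pi.neg_apply, Pi.neg_apply, det_neg,
    Fintype.card_coe, (mem_powersetCard.1 hI).2, ← mul_assoc, ← mul_pow, neg_one_mul,
    neg_neg, one_pow, one_mul]

theorem charpolyRev_permMatrix_conj (u h : Perm α) :
    ((h⁻¹ * u * h).permMatrix ℚ).charpolyRev = (u.permMatrix ℚ).charpolyRev := by
  have hconj : IsConj (h⁻¹ * u * h) u := isConj_iff.2 ⟨h, by group⟩
  rw [charpolyRev_permMatrix, charpolyRev_permMatrix, Perm.partition_eq_of_isConj.1 hconj]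

theorem compl_map_equiv (Y : Finset α) (p : Perm α) :
    (Y.map p.toEmbedding)ᶜ = Yᶜ.map p.toEmbedding := by
  ext x
  rw [mem_compl, mem_map_equiv, mem_map_equiv, mem_compl]

theorem classTrace_symmetrizer_mul_antisymmetrizer (u : Perm α) (Y : Finset α) :
    classTrace u (symmetrizer Yᶜ * antisymmetrizer Y) =
      Y.card.factorial * (Fintype.card α - Y.card).factorial *
        ((-1) ^ Y.card * (u.permMatrix ℚ).charpolyRev.coeff Y.card) := by
  have hconst : ∀ I ∈ powersetCard Y.card univ,
      classTrace u (symmetrizer Iᶜ * antisymmetrizer I) =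
        classTrace u (symmetrizer Yᶜ * antisymmetrizer Y) := fun I hI => by
    obtain ⟨p, rfl⟩ := exists_perm_map_eq (mem_powersetCard.1 hI).2.symm
    rw [compl_map_equiv, classTrace_symmetrizer_mul_antisymmetrizer_map]
  have hsum : ∑ I ∈ powersetCard Y.card univ,
      classTrace u (symmetrizer Iᶜ * antisymmetrizer I) = (Fintype.card α).factorial *
        ((-1) ^ Y.card * (u.permMatrix ℚ).charpolyRev.coeff Y.card) := by
    simp_rw [classTrace_apply]
    rw [sum_comm]
    simp_rw [sum_coeff_symmetrizer_mul_antisymmetrizer, charpolyRev_permMatrix_conj]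
    rw [sum_const, card_univ, Fintype.card_perm, nsmul_eq_mul]
  rw [sum_congr rfl hconst, sum_const, card_powersetCard, card_univ, nsmul_eq_mul] at hsum
  have hle : Y.card ≤ Fintype.card α := card_le_univ _
  refine mul_left_cancel₀ (Nat.cast_ne_zero.2 (Nat.choose_pos hle).ne') (hsum.trans ?_)
  rw [← Nat.choose_mul_factorial_mul_factorial hle]
  push_cast
  ring

theorem classTrace_hookElement_congr (u : Perm α) {Y : Finset α} {o x : α} (ho : o ∉ Y)
    (hx : x ∉ Y) : classTrace u (hookElement x Y) = classTrace u (hookElement o Y) := by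
  have hrow : Yᶜ.map (swap o x).toEmbedding = Yᶜ := map_perm fun z hz => by
    rw [coe_compl, Set.mem_compl_iff, mem_coe]
    exact fun hzY => hz (swap_apply_of_ne_of_ne (ne_of_mem_of_not_mem hzY ho)
      (ne_of_mem_of_not_mem hzY hx))
  have hcol : Y.map (swap o x).toEmbedding = Y := compl_injective (by rw [compl_map_equiv, hrow])
  rw [hookElement, hookElement,
    ← classTrace_symmetrizer_mul_antisymmetrizer_map u (swap o x) Yᶜ (insert o Y), map_insert,
    hrow, hcol, Equiv.coe_toEmbedding, swap_apply_left]

theorem classTrace_hookElement_recursion (u : Perm α) {Y : Finset α} {o : α} (ho : o ∉ Y) :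
    ((Fintype.card α - Y.card : ℕ) : ℚ) * classTrace u (hookElement o Y) +
        ∑ y ∈ Y, classTrace u (hookElement y (Y.erase y)) =
      Fintype.card α * (Y.card.factorial * (Fintype.card α - Y.card).factorial *
        ((-1) ^ Y.card * (u.permMatrix ℚ).charpolyRev.coeff Y.card)) := by
  have hrow : ∑ x ∈ Yᶜ, classTrace u (symmetrizer Yᶜ * antisymmetrizer (insert x Y)) =
      ((Fintype.card α - Y.card : ℕ) : ℚ) * classTrace u (hookElement o Y) := by
    rw [← card_compl, ← nsmul_eq_mul, ← sum_const]
    exact sum_congr rfl fun x hx => classTrace_hookElement_congr u ho (mem_compl.1 hx)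
  have hcol : ∀ y ∈ Y, hookElement y (Y.erase y) = symmetrizer (insert y Yᶜ) * antisymmetrizer Y :=
    fun y hy => by rw [hookElement, compl_erase, insert_erase hy]
  have h := congrArg (classTrace u)
    (sum_symmetrizer_mul_antisymmetrizer_insert (X := Yᶜ) (Y := Y) disjoint_compl_left)
  rw [map_add, map_sum, map_sum, hrow, map_nsmul, classTrace_symmetrizer_mul_antisymmetrizer,
    add_comm (Yᶜ.card), card_add_card_compl, nsmul_eq_mul] at h
  rwa [sum_congr rfl fun y hy => congrArg (classTrace u) (hcol y hy)]

end HookTrace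

section HookPoly

open Polynomial

variable {α : Type*} [Fintype α] [DecidableEq α]

/-- The polynomial `det (1 - X P) / (1 - X)`, where `P` is the matrix of the permutation `u`. Up to
signs, its coefficients are the values at `u` of the characters of hook shape. -/
def hookPoly (u : Perm α) : ℚ[X] :=
  (u.permMatrix ℚ).charpolyRev / (1 - X)

theorem hookPoly_eq_of_parts_cons {u : Perm α} {c : ℕ} {s : Multiset ℕ}
    (h : u.partition.parts = c ::ₘ s) :
    hookPoly u = (∑ i ∈ range c, X ^ i) * (s.map fun c => (1 - X ^ c : ℚ[X])).prod := by
  rw [hookPoly, charpolyRev_permMatrix, h, Multiset.map_cons, Multiset.prod_cons,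
    ← mul_neg_geom_sum, mul_assoc, mul_div_cancel_left₀ _ (one_sub_X_ne_zero (R := ℚ))]

theorem hookPoly_inv (u : Perm α) : hookPoly u⁻¹ = hookPoly u := by
  rw [hookPoly, hookPoly, charpolyRev_permMatrix, charpolyRev_permMatrix, Perm.parts_partition,
    Perm.parts_partition, Perm.cycleType_inv, Perm.support_inv]

theorem hookPoly_of_parts_singleton {u : Perm α} {c : ℕ} (h : u.partition.parts = {c}) :
    hookPoly u = ∑ i ∈ range c, X ^ i := by
  rw [hookPoly_eq_of_parts_cons (c := c) (s := 0) h, Multiset.map_zero, Multiset.prod_zero, mul_one]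

theorem eval_one_hookPoly_of_parts_cons_cons {u : Perm α} {b c : ℕ} {s : Multiset ℕ}
    (h : u.partition.parts = b ::ₘ c ::ₘ s) : (hookPoly u).eval 1 = 0 := by
  rw [hookPoly_eq_of_parts_cons h, Multiset.map_cons, Multiset.prod_cons]
  simp

variable [Nonempty α]

theorem exists_parts_eq_cons (u : Perm α) : ∃ c s, u.partition.parts = c ::ₘ s := by
  have hparts : u.partition.parts ≠ 0 := fun h => Fintype.card_ne_zero (α := α) <| by
    rw [← u.partition.parts_sum, h, Multiset.sum_zero]
  obtain ⟨c, hc⟩ := Multiset.exists_mem_of_ne_zero hparts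
  exact ⟨c, Multiset.exists_cons_of_mem hc⟩

theorem one_sub_X_mul_hookPoly (u : Perm α) :
    (1 - X) * hookPoly u = (u.permMatrix ℚ).charpolyRev := by
  obtain ⟨c, s, h⟩ := exists_parts_eq_cons u
  rw [hookPoly_eq_of_parts_cons h, charpolyRev_permMatrix, h, Multiset.map_cons,
    Multiset.prod_cons, ← mul_assoc, mul_neg_geom_sum]

theorem natDegree_hookPoly_lt (u : Perm α) : (hookPoly u).natDegree < Fintype.card α := by
  have hdeg : (u.permMatrix ℚ).charpolyRev.natDegree ≤ Fintype.card α := by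
    rw [← Matrix.reverse_charpoly, ← Matrix.charpoly_natDegree_eq_dim (u.permMatrix ℚ)]
    exact reverse_natDegree_le _
  rcases eq_or_ne (hookPoly u) 0 with h | h
  · rw [h, natDegree_zero]
    exact Fintype.card_pos
  · have hX : (1 - X : ℚ[X]).natDegree = 1 := by
      rw [natDegree_sub_eq_right_of_natDegree_lt (by simp), natDegree_X]
    rw [← one_sub_X_mul_hookPoly, natDegree_mul one_sub_X_ne_zero h, hX] at hdeg
    lia

theorem eval_one_hookPoly (u : Perm α) :
    (hookPoly u).eval 1 =
      if u.partition.parts = {Fintype.card α} then (Fintype.card α : ℚ) else 0 := by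
  split_ifs with h
  · simp [hookPoly_of_parts_singleton h, eval_finsetSum]
  obtain ⟨b, s, hs⟩ := exists_parts_eq_cons u
  induction s using Multiset.induction_on with
  | empty => exact absurd (by simpa [hs] using u.partition.parts_sum) h
  | cons c s _ => exact eval_one_hookPoly_of_parts_cons_cons hs

end HookPoly

section HookTrace

variable {α : Type*} [Fintype α] [DecidableEq α]

theorem classTrace_hookElement (u : Perm α) {Y : Finset α} {o : α} (ho : o ∉ Y) :
    classTrace u (hookElement o Y) =
      Fintype.card α * ((Fintype.card α - Y.card - 1).factorial * Y.card.factorial *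
        ((-1) ^ Y.card * (hookPoly u).coeff Y.card)) := by
  have : Nonempty α := ⟨o⟩
  induction hk : Y.card generalizing Y o with
  | zero =>
    have h := classTrace_hookElement_recursion u ho
    rw [card_eq_zero.1 hk, card_empty, sum_empty, add_zero, ← one_sub_X_mul_hookPoly] at h
    rw [card_eq_zero.1 hk]
    have hd : (Fintype.card α : ℚ) ≠ 0 := by positivity
    refine mul_left_cancel₀ hd (h.trans ?_)
    rw [Nat.sub_zero, ← Nat.mul_factorial_pred Fintype.card_ne_zero]
    simp only [Nat.factorial_zero, Nat.cast_one, Nat.cast_mul, one_mul, pow_zero, mul_one,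
      Polynomial.mul_coeff_zero, Polynomial.coeff_sub, Polynomial.coeff_one_zero,
      Polynomial.coeff_X_zero, sub_zero]
    ring
  | succ k ih =>
    have hlt : k + 1 < Fintype.card α := hk ▸ card_lt_univ_of_notMem ho
    obtain ⟨m, hm⟩ : ∃ m, Fintype.card α - k - 1 = m + 1 := ⟨Fintype.card α - k - 2, by lia⟩
    have h := classTrace_hookElement_recursion u ho
    rw [sum_congr rfl fun y hy =>
      ih (notMem_erase y Y) (by rw [card_erase_of_mem hy, hk, Nat.add_sub_cancel]), sum_const,
      nsmul_eq_mul, hk, ← Nat.sub_sub, hm, ← eq_sub_iff_add_eq, ← one_sub_X_mul_hookPoly, sub_mul,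
      one_mul, Polynomial.coeff_sub, Polynomial.coeff_X_mul] at h
    rw [← Nat.sub_sub, hm, Nat.add_sub_cancel]
    have hm0 : ((m + 1 : ℕ) : ℚ) ≠ 0 := by positivity
    refine mul_left_cancel₀ hm0 (h.trans ?_)
    rw [Nat.factorial_succ m, Nat.factorial_succ k]
    push_cast
    ring

end HookTrace

section HookPartition

theorem eq_replicate_one_of_sum_le_card {s : Multiset ℕ} (hpos : ∀ a ∈ s, 0 < a)
    (h : s.sum ≤ s.card) : s = Multiset.replicate s.card 1 := by
  have hle : s.card ≤ s.sum := by simpa using Multiset.card_nsmul_le_sum (a := 1) hpos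
  refine Multiset.eq_replicate_card.2 fun a ha => ?_
  obtain ⟨t, rfl⟩ := Multiset.exists_cons_of_mem ha
  have ht : t.card ≤ t.sum := by
    simpa using Multiset.card_nsmul_le_sum (a := 1) fun b hb => hpos b (Multiset.mem_cons_of_mem hb)
  have ha0 := hpos a ha
  rw [Multiset.sum_cons, Multiset.card_cons] at h
  lia

variable {d : ℕ}

/-- The hook partition `(d - k, 1, …, 1)` of `d` with `k + 1` parts. -/
def hook (k : Fin d) : Nat.Partition d where
  parts := (d - k) ::ₘ Multiset.replicate k 1
  parts_pos {i} hi := by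
    rcases Multiset.mem_cons.1 hi with rfl | h
    · exact Nat.sub_pos_of_lt k.2
    · rw [Multiset.eq_of_mem_replicate h]
      exact one_pos
  parts_sum := by simp

theorem hook_injective : Function.Injective (hook : Fin d → Nat.Partition d) := fun k l h => by
  have hcard := congrArg (fun p => p.parts.card) h
  simp only [hook, Multiset.card_cons, Multiset.card_replicate] at hcard
  exact Fin.ext (Nat.succ_injective hcard)

theorem rows_hook (k : Fin d) : rows (hook k) = (d - k) :: List.replicate k 1 := by
  have hsorted : ((d - k) :: List.replicate k 1 : List ℕ).Pairwise (· ≥ ·) :=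
    List.pairwise_cons.2 ⟨fun a ha => by rw [List.eq_of_mem_replicate ha]; lia,
      List.pairwise_replicate.2 (Or.inr le_rfl)⟩
  refine List.Perm.eq_of_pairwise' (Multiset.pairwise_sort _ _) hsorted ?_
  rw [← Multiset.coe_eq_coe, rows, Multiset.sort_eq, ← Multiset.cons_coe, Multiset.coe_replicate]
  rfl

theorem mem_diagram_hook {k : Fin d} {c : ℕ × ℕ} :
    c ∈ diagram (hook k) ↔ (c.1 = 0 ∧ c.2 < d - k) ∨ (c.2 = 0 ∧ c.1 ≤ k) := by
  have hk := k.2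
  rw [diagram, YoungDiagram.mem_ofRowLens]
  simp only [rows_hook]
  rcases c with ⟨_ | i, j⟩
  · simp only [List.getElem_cons_zero, List.length_cons, Nat.zero_lt_succ, exists_const]
    lia
  · simp only [List.getElem_cons_succ, List.getElem_replicate, List.length_cons,
      List.length_replicate, exists_prop]
    lia

theorem eq_hook_of_le {lam : Nat.Partition d} {k : Fin d} {p : ℕ} (hp : p ∈ lam.parts)
    (hp' : d - k ≤ p) (hk : k + 1 ≤ lam.parts.card) : lam = hook k := by
  obtain ⟨s, hs⟩ := Multiset.exists_cons_of_mem hp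
  have hsum := lam.parts_sum
  rw [hs, Multiset.sum_cons] at hsum
  rw [hs, Multiset.card_cons] at hk
  have hpos : ∀ a ∈ s, 0 < a := fun a ha => lam.parts_pos (hs ▸ Multiset.mem_cons_of_mem ha)
  have hle : s.card ≤ s.sum := by simpa using Multiset.card_nsmul_le_sum (a := 1) hpos
  have := k.2
  refine Nat.Partition.ext ?_
  rw [hs, eq_replicate_one_of_sum_le_card hpos (by lia), show s.card = k by lia,
    show p = d - k by lia]
  rfl

end HookPartition

section YoungTableau

/-- The subgroup of the permutations that preserve every fibre of `f`. -/
def fiberPerms {α β : Type*} (f : α → β) : Subgroup (Perm α) where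
  carrier := {p | ∀ x, f (p x) = f x}
  one_mem' _ := rfl
  mul_mem' hp hq x := (hp _).trans (hq x)
  inv_mem' {p} hp x := by rw [← hp (p⁻¹ x), ← Perm.mul_apply, mul_inv_cancel, Perm.one_apply]

theorem fiberPerms_eq_permsOn {α β : Type*} {f : α → β} {X : Finset α} {b : β}
    (hX : ∀ x ∈ X, f x = b) (hinj : ∀ x y, x ∉ X → f x = f y → x = y) :
    fiberPerms f = permsOn X := by
  ext p
  rw [mem_permsOn]
  refine ⟨fun hp x hx => (hinj x (p x) hx (hp x).symm).symm, fun hp x => ?_⟩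
  by_cases hx : x ∈ X
  · rw [hX x hx, hX _ (apply_mem_of_mem_permsOn (mem_permsOn.2 hp) hx)]
  · rw [hp x hx]

variable {d : ℕ}

theorem rowSymmetrizer_eq_charSum {lam : Nat.Partition d} (T : Tableau lam) :
    rowSymmetrizer T = charSum 1 (fiberPerms fun x => (T x).1.1 : Set (Perm (Fin d))) := by
  classical
  exact sum_congr (Finset.ext fun p => by rw [mem_filter_univ, mem_filter_univ]; rfl)
    fun _ _ => rfl

theorem colAntisymmetrizer_eq_charSum {lam : Nat.Partition d} (T : Tableau lam) :
    colAntisymmetrizer T =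
      charSum (signChar (Fin d)) (fiberPerms fun x => (T x).1.2 : Set (Perm (Fin d))) := by
  classical
  exact sum_congr (Finset.ext fun p => by rw [mem_filter_univ, mem_filter_univ]; rfl)
    fun _ _ => rfl

theorem tableau_ext {lam : Nat.Partition d} (T : Tableau lam) {x y : Fin d}
    (hrow : (T x).1.1 = (T y).1.1) (hcol : (T x).1.2 = (T y).1.2) : x = y :=
  T.injective (Subtype.ext (Prod.ext hrow hcol))

variable {k : Fin d} (T : Tableau (hook k))

theorem hook_cell (x : Fin d) :
    ((T x).1.1 = 0 ∧ (T x).1.2 < d - k) ∨ ((T x).1.2 = 0 ∧ (T x).1.1 ≤ k) :=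
  mem_diagram_hook.1 (T x).2

theorem card_filter_row_ne_zero : #{x | (T x).1.1 ≠ 0} = k := by
  have hcol {x : Fin d} (hx : (T x).1.1 ≠ 0) : (T x).1.2 = 0 ∧ (T x).1.1 ≤ k :=
    (hook_cell T x).resolve_left fun h => hx h.1
  rw [← Nat.add_sub_cancel (n := (k : ℕ)) (m := 1), ← Nat.card_Icc]
  refine card_nbij (fun x => (T x).1.1) (fun x hx => ?_) (fun x hx y hy h => ?_) fun i hi => ?_
  · rw [mem_coe, mem_filter_univ] at hx
    exact mem_coe.2 <| mem_Icc.2 ⟨Nat.one_le_iff_ne_zero.2 hx, (hcol hx).2⟩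
  · rw [mem_coe, mem_filter_univ] at hx hy
    exact tableau_ext T h ((hcol hx).1.trans (hcol hy).1.symm)
  · rw [mem_coe, mem_Icc] at hi
    have hcell : ((i, 0) : ℕ × ℕ) ∈ (diagram (hook k)).cells :=
      mem_diagram_hook.2 (Or.inr ⟨rfl, hi.2⟩)
    exact ⟨T.symm ⟨(i, 0), hcell⟩, by
      rw [mem_coe, mem_filter_univ, apply_symm_apply]
      exact Nat.one_le_iff_ne_zero.1 hi.1, by simp⟩

theorem exists_hookElement_eq_youngSymmetrizer :
    ∃ (o : Fin d) (Y : Finset (Fin d)),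
      o ∉ Y ∧ Y.card = k ∧ youngSymmetrizer T = hookElement o Y := by
  have hcorner : ((0, 0) : ℕ × ℕ) ∈ (diagram (hook k)).cells :=
    mem_diagram_hook.2 (Or.inr ⟨rfl, Nat.zero_le _⟩)
  obtain ⟨o, ho⟩ := T.surjective ⟨(0, 0), hcorner⟩
  set Y : Finset (Fin d) := {x | (T x).1.1 ≠ 0} with hY
  refine ⟨o, Y, by simp [hY, ho], card_filter_row_ne_zero T, ?_⟩
  have hrow : fiberPerms (fun x => (T x).1.1) = permsOn Yᶜ := by
    refine fiberPerms_eq_permsOn (b := 0) (fun x hx => by simpa [hY] using hx) fun x y hx h => ?_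
    have hx0 : (T x).1.1 ≠ 0 := by simpa [hY] using hx
    exact tableau_ext T h (by have := hook_cell T x; have := hook_cell T y; lia)
  have hmem (x : Fin d) : x ∈ insert o Y ↔ (T x).1.2 = 0 := by
    rw [mem_insert, hY, mem_filter_univ]
    refine ⟨?_, fun hx => or_iff_not_imp_right.2 fun h => ?_⟩
    · rintro (rfl | hx)
      · rw [ho]
      · exact ((hook_cell T x).resolve_left fun h => hx h.1).1
    · exact tableau_ext T (by rw [ho, not_not.1 h]) (by rw [ho, hx])
  have hcol : fiberPerms (fun x => (T x).1.2) = permsOn (insert o Y) := by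
    refine fiberPerms_eq_permsOn (b := 0) (fun x hx => (hmem x).1 hx) fun x y hx h => ?_
    rw [hmem] at hx
    exact tableau_ext T (by have := hook_cell T x; have := hook_cell T y; lia) h
  rw [youngSymmetrizer, rowSymmetrizer_eq_charSum, colAntisymmetrizer_eq_charSum, hrow, hcol]
  rfl

theorem classTrace_youngSymmetrizer_hook (u : Perm (Fin d)) :
    classTrace u (youngSymmetrizer T) =
      d * ((d - k - 1).factorial * (k : ℕ).factorial *
        ((-1) ^ (k : ℕ) * (hookPoly u).coeff k)) := by
  obtain ⟨o, Y, ho, hcard, hT⟩ := exists_hookElement_eq_youngSymmetrizer T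
  rw [hT, classTrace_hookElement u ho, hcard, Fintype.card_fin]

theorem chi_hook (k : Fin d) (mu : Nat.Partition d) :
    chi (hook k) mu = (-1) ^ (k : ℕ) * (hookPoly (permOfType mu)).coeff k := by
  obtain ⟨o, Y, ho, hcard, hT⟩ := exists_hookElement_eq_youngSymmetrizer (tableau (hook k))
  have hd : (d : ℚ) ≠ 0 := Nat.cast_ne_zero.2 (Nat.ne_zero_of_lt k.2)
  have hn : ((d - k - 1).factorial * (k : ℕ).factorial * d : ℚ) ≠ 0 := by positivity
  have hsq := hookElement_mul_self ho
  rw [← hT, hcard, Fintype.card_fin] at hsq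
  refine (character_span_of_mul_self hn hsq _).trans ?_
  rw [classTrace_youngSymmetrizer_hook, hookPoly_inv]
  field_simp

end YoungTableau

section NonHook

open MonoidAlgebra

theorem swap_mem_fiberPerms {α β : Type*} [DecidableEq α] {f : α → β} {x y : α} (h : f x = f y) :
    swap x y ∈ fiberPerms f := fun z => by
  rw [swap_apply_def]
  split_ifs with hx hy
  exacts [by rw [hx, h], by rw [hy, h], rfl]

theorem charSum_permsOn_mul_mul_charSum_fiberPerms {α β k : Type*} [Fintype α] [DecidableEq α]
    [CommRing k] [IsDomain k] {χ ψ : Perm α →* k}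
    (hne : ∀ s t : Perm α, s.IsSwap → t.IsSwap → χ s ≠ ψ t) {X : Finset α} {f : α → β}
    {B : Finset β} (hf : ∀ x, f x ∈ B) (hB : B.card < X.card) (z : MonoidAlgebra k (Perm α)) :
    charSum χ (permsOn X : Set (Perm α)) * z *
      charSum ψ (fiberPerms f : Set (Perm α)) = 0 := by
  refine mul_mul_eq_zero_of_single (fun u => ?_) z
  obtain ⟨a, ha, b, hb, hab, hfab⟩ :=
    exists_ne_map_eq_of_card_lt_of_maps_to (f := fun x => f (u⁻¹ x)) hB fun x _ => hf (u⁻¹ x)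
  have hconj : u * swap (u⁻¹ a) (u⁻¹ b) * u⁻¹ = swap a b := by
    rw [← swap_apply_apply, ← Perm.mul_apply, ← Perm.mul_apply, mul_inv_cancel, Perm.one_apply,
      Perm.one_apply]
  refine charSum_mul_single_mul_charSum_eq_zero χ ψ (swap_mem_fiberPerms hfab)
    (hconj ▸ swap_mem_permsOn ha hb) (hconj ▸ hne _ _ ⟨a, b, hab, rfl⟩ ⟨_, _, ?_, rfl⟩)
  exact fun h => hab (u⁻¹.injective h)

theorem signChar_of_isSwap {α : Type*} [Fintype α] [DecidableEq α] {t : Perm α} (ht : t.IsSwap) :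
    signChar α t = -1 := by
  obtain ⟨x, y, hxy, rfl⟩ := ht
  exact signChar_swap hxy

variable {d : ℕ} {lam : Nat.Partition d}

theorem row_lt (T : Tableau lam) (x : Fin d) : (T x).1.1 < lam.parts.card := by
  obtain ⟨h, -⟩ := YoungDiagram.mem_ofRowLens.1 (T x).2
  simpa [rows] using h

theorem exists_col_lt (T : Tableau lam) (x : Fin d) : ∃ p ∈ lam.parts, (T x).1.2 < p := by
  obtain ⟨h, hlt⟩ := YoungDiagram.mem_ofRowLens.1 (T x).2
  exact ⟨_, (Multiset.mem_sort _).1 (List.getElem_mem h), hlt⟩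

theorem antisymmetrizer_mul_mul_rowSymmetrizer (T : Tableau lam) {X : Finset (Fin d)}
    (h : lam.parts.card < X.card) (z : MonoidAlgebra ℚ (Perm (Fin d))) :
    antisymmetrizer X * z * rowSymmetrizer T = 0 := by
  rw [rowSymmetrizer_eq_charSum]
  refine charSum_permsOn_mul_mul_charSum_fiberPerms (B := range lam.parts.card)
    (fun s t hs _ => ?_) (fun x => mem_range.2 (row_lt T x)) (by rwa [card_range]) z
  rw [signChar_of_isSwap hs, MonoidHom.one_apply]
  norm_num

theorem symmetrizer_mul_mul_colAntisymmetrizer (T : Tableau lam) {X : Finset (Fin d)}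
    (hX : X.Nonempty) (h : ∀ p ∈ lam.parts, p < X.card) (z : MonoidAlgebra ℚ (Perm (Fin d))) :
    symmetrizer X * z * colAntisymmetrizer T = 0 := by
  rw [colAntisymmetrizer_eq_charSum]
  refine charSum_permsOn_mul_mul_charSum_fiberPerms (B := range (X.card - 1))
    (fun s t _ ht => ?_) (fun x => ?_) (by rw [card_range]; exact Nat.pred_lt hX.card_ne_zero) z
  · rw [signChar_of_isSwap ht, MonoidHom.one_apply]
    norm_num
  · obtain ⟨p, hp, hlt⟩ := exists_col_lt T x
    exact mem_range.2 (hlt.trans_le (Nat.le_pred_of_lt (h p hp)))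

theorem youngSymmetrizer_hook_mul_mul_youngSymmetrizer (h : lam ∉ Set.range hook) {k : Fin d}
    (T : Tableau (hook k)) (S : Tableau lam) (z : MonoidAlgebra ℚ (Perm (Fin d))) :
    youngSymmetrizer T * z * youngSymmetrizer S = 0 := by
  obtain ⟨o, Y, ho, hcard, hT⟩ := exists_hookElement_eq_youngSymmetrizer T
  have hcol : (insert o Y).card = k + 1 := by rw [card_insert_of_notMem ho, hcard]
  have hrow : Yᶜ.card = d - k := by rw [card_compl, hcard, Fintype.card_fin]
  rw [hT, hookElement, youngSymmetrizer]
  rcases lt_or_ge lam.parts.card (k + 1) with hk | hk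
  · rw [← mul_assoc, mul_assoc _ _ z, mul_assoc _ _ (rowSymmetrizer S),
      antisymmetrizer_mul_mul_rowSymmetrizer S (hcol ▸ hk), mul_zero, zero_mul]
  · have hlt : ∀ p ∈ lam.parts, p < Yᶜ.card := fun p hp => by
      rw [hrow]
      by_contra! hp'
      exact h ⟨k, (eq_hook_of_le hp hp' hk).symm⟩
    rw [mul_assoc (symmetrizer _), ← mul_assoc, mul_assoc (symmetrizer _),
      symmetrizer_mul_mul_colAntisymmetrizer S ⟨o, mem_compl.2 ho⟩ hlt]

theorem partition_permOfType (mu : Nat.Partition d) :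
    (permOfType mu).partition.parts = mu.parts :=
  (exists_perm_of_type mu).choose_spec

theorem character_eq_chi (lam mu : Nat.Partition d) {u : Perm (Fin d)}
    (h : u.partition.parts = mu.parts) : (spechtRep lam).character u = chi lam mu := by
  have hconj : IsConj (permOfType mu) u :=
    Perm.partition_eq_of_isConj.2 (Nat.Partition.ext ((partition_permOfType mu).trans h.symm))
  obtain ⟨c, hc⟩ := isConj_iff.1 hconj
  rw [← hc, Representation.char_conj, chi]

theorem sum_coeff_hookPoly_mul_character (h : lam ∉ Set.range hook) (k : Fin d) :
    ∑ u, (hookPoly u).coeff k * (spechtRep lam).character u = 0 := by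
  have hd : (d : ℚ) ≠ 0 := Nat.cast_ne_zero.2 (Nat.ne_zero_of_lt k.2)
  have hc : (d * ((d - k - 1).factorial * (k : ℕ).factorial * (-1) ^ (k : ℕ)) : ℚ) ≠ 0 := by
    refine mul_ne_zero hd (mul_ne_zero (by positivity) (pow_ne_zero _ (by norm_num)))
  have hsum := sum_classTrace_mul_character (spechtRep lam) (youngSymmetrizer (tableau (hook k)))
  have hzero : (spechtRep lam).asAlgebraHom (youngSymmetrizer (tableau (hook k))) = 0 :=
    asAlgebraHom_span_eq_zero (youngSymmetrizer_hook_mul_mul_youngSymmetrizer h _ _)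
  rw [hzero, map_zero, mul_zero] at hsum
  refine (mul_eq_zero.1 (Eq.trans ?_ hsum)).resolve_left hc
  rw [mul_sum]
  refine sum_congr rfl fun u _ => ?_
  rw [classTrace_youngSymmetrizer_hook]
  ring

theorem chi_indiscrete_of_notMem_range_hook (h : lam ∉ Set.range hook) (hd : d ≠ 0) :
    chi lam (Nat.Partition.indiscrete d) = 0 := by
  have : NeZero d := ⟨hd⟩
  have heval (u : Perm (Fin d)) : ∑ k : Fin d, (hookPoly u).coeff k =
      if u.partition.parts = {d} then (d : ℚ) else 0 := by
    have hu := eval_one_hookPoly u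
    simp only [Fintype.card_fin] at hu
    rw [← hu, Polynomial.eval_eq_sum_range' (by simpa using natDegree_hookPoly_lt u),
      ← Fin.sum_univ_eq_sum_range fun i => (hookPoly u).coeff i * 1 ^ i]
    simp only [one_pow, mul_one]
  have hsum : ∑ u : Perm (Fin d), (if u.partition.parts = {d} then (d : ℚ) else 0) *
      (spechtRep lam).character u = 0 := by
    simp_rw [← heval, sum_mul]
    rw [sum_comm]
    exact sum_eq_zero fun k _ => sum_coeff_hookPoly_mul_character h k
  have hlong {u : Perm (Fin d)} (hu : u.partition.parts = {d}) :
      (spechtRep lam).character u = chi lam (Nat.Partition.indiscrete d) :=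
    character_eq_chi _ _ (hu.trans (Nat.Partition.indiscrete_parts hd).symm)
  simp_rw [ite_mul, zero_mul] at hsum
  rw [← sum_filter, sum_congr rfl fun u hu => congrArg _ (hlong (mem_filter.1 hu).2),
    sum_const, nsmul_eq_mul] at hsum
  have hmem : permOfType (Nat.Partition.indiscrete d) ∈
      ({u | u.partition.parts = {d}} : Finset (Perm (Fin d))) :=
    (mem_filter_univ _).2 ((partition_permOfType _).trans (Nat.Partition.indiscrete_parts hd))
  refine (mul_eq_zero.1 ((mul_eq_zero.1 hsum).resolve_left ?_)).resolve_left (Nat.cast_ne_zero.2 hd)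
  exact Nat.cast_ne_zero.2 (card_ne_zero_of_mem hmem)

end NonHook

section HookSum

variable {d : ℕ}

theorem chi_hook_indiscrete (k : Fin d) :
    chi (hook k) (Nat.Partition.indiscrete d) = (-1) ^ (k : ℕ) := by
  have hlong := (partition_permOfType (Nat.Partition.indiscrete d)).trans
    (Nat.Partition.indiscrete_parts (Nat.ne_zero_of_lt k.2))
  rw [chi_hook, hookPoly_of_parts_singleton hlong, Polynomial.finsetSum_coeff]
  simp [Polynomial.coeff_X_pow]

theorem sum_get_cons_replicate {M : Type*} [AddCommMonoid M] (f : ℕ → ℕ → M) (a b m : ℕ)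
    {l : List ℕ} (hl : l = a :: List.replicate m b) :
    ∑ i : Fin l.length, f (l.get i) i = f a 0 + ∑ i ∈ range m, f b (i + 1) := by
  subst hl
  refine (Fin.sum_univ_succ (n := (List.replicate m b).length) _).trans (congrArg (f a 0 + ·) ?_)
  rw [← Fin.sum_univ_eq_sum_range (fun i => f b (i + 1)) m]
  exact Fintype.sum_equiv (finCongr List.length_replicate) _ _ fun i => by simp

theorem shiftedPowerSum_hook (m : ℕ) (k : Fin d) :
    shiftedPowerSum m (hook k) = ((d : ℚ) - k - 1 / 2) ^ m - (-k - 1 / 2) ^ m := by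
  have hget := sum_get_cons_replicate (fun a i : ℕ =>
    ((a : ℚ) - ((i : ℚ) + 1) + 1 / 2) ^ m - (-((i : ℚ) + 1) + 1 / 2) ^ m) _ _ _ (rows_hook k)
  calc shiftedPowerSum m (hook k)
      = (((d : ℚ) - k - 1 / 2) ^ m - (-((0 : ℕ) : ℚ) - 1 / 2) ^ m) +
          ∑ i ∈ range k, ((-(i : ℚ) - 1 / 2) ^ m - (-((i + 1 : ℕ) : ℚ) - 1 / 2) ^ m) := by
        rw [shiftedPowerSum, hget, Nat.cast_sub k.2.le]
        refine congrArg₂ (· + ·) ?_ (sum_congr rfl fun i _ => ?_) <;> push_cast <;> ring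
    _ = ((d : ℚ) - k - 1 / 2) ^ m - (-k - 1 / 2) ^ m := by
        rw [sum_range_sub' fun i : ℕ => (-(i : ℚ) - 1 / 2) ^ m, sub_add_sub_cancel]

theorem shiftedPowerSum_three_hook (k : Fin d) :
    shiftedPowerSum (2 + 1) (hook k) / ((2 + 1).factorial : ℚ) =
      d / 2 * ((k - ((d : ℚ) - 1) / 2) ^ 2 + (d : ℚ) ^ 2 / 12) := by
  rw [shiftedPowerSum_hook, Nat.factorial_succ, Nat.factorial_two]
  push_cast
  ring

theorem sum_chi_indiscrete_mul_mul_chi (hd : d ≠ 0) (f : Nat.Partition d → ℚ)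
    (mu : Nat.Partition d) :
    ∑ lam, chi lam (Nat.Partition.indiscrete d) * f lam * chi lam mu =
      ∑ k : Fin d, (hookPoly (permOfType mu)).coeff k * f (hook k) := by
  refine (Fintype.sum_of_injective hook hook_injective _ _ (fun lam h => ?_) fun k => ?_).symm
  · rw [chi_indiscrete_of_notMem_range_hook h hd, zero_mul, zero_mul]
  · rw [chi_hook_indiscrete, chi_hook, mul_right_comm, ← mul_assoc, ← mul_pow, neg_one_mul,
      neg_neg, one_pow, one_mul]

end HookSum

section Series

open PowerSeries

/-- The power series `exp (c u)` in the variable `u`. -/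
def expSeries (c : ℚ) : PowerSeries ℚ := rescale c (exp ℚ)

/-- The power series `2 sinh (c u / 2)`. -/
def sinhSeries (c : ℚ) : PowerSeries ℚ := expSeries (c / 2) - expSeries (-(c / 2))

/-- The power series `2 sinh (u / 2) / u`, usually written `𝒮(u)`. -/
def sinhQuotient : PowerSeries ℚ := mk fun j => coeff (j + 1) (sinhSeries 1)

theorem expSeries_add (a b : ℚ) : expSeries (a + b) = expSeries a * expSeries b :=
  (exp_mul_exp_eq_exp_add a b).symm

theorem expSeries_zero : expSeries 0 = 1 := by
  simp [expSeries]

theorem expSeries_natCast (k : ℕ) : expSeries k = exp ℚ ^ k :=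
  (exp_pow_eq_rescale_exp k).symm

theorem expSeries_sum {ι : Type*} (s : Finset ι) (f : ι → ℚ) :
    expSeries (∑ i ∈ s, f i) = ∏ i ∈ s, expSeries (f i) := by
  classical
  induction s using Finset.induction_on with
  | empty => simp [expSeries_zero]
  | insert a s ha ih => rw [sum_insert ha, prod_insert ha, expSeries_add, ih]

theorem coeff_expSeries (c : ℚ) (j : ℕ) : coeff j (expSeries c) = c ^ j / j.factorial := by
  simp [expSeries, coeff_rescale, coeff_exp, div_eq_mul_inv]

theorem one_sub_expSeries (c : ℚ) : 1 - expSeries c = -(expSeries (c / 2) * sinhSeries c) := by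
  rw [sinhSeries, mul_sub, ← expSeries_add, ← expSeries_add, add_neg_cancel, expSeries_zero,
    add_halves, neg_sub]

theorem constantCoeff_sinhQuotient : constantCoeff sinhQuotient = 1 := by
  rw [← coeff_zero_eq_constantCoeff_apply, sinhQuotient, coeff_mk, sinhSeries, map_sub,
    coeff_expSeries, coeff_expSeries]
  norm_num

theorem sinhSeries_eq (c : ℚ) : sinhSeries c = C c * X * rescale c sinhQuotient := by
  ext j
  rw [mul_assoc, coeff_C_mul]
  rcases j with _ | j
  · rw [sinhSeries, map_sub, coeff_expSeries, coeff_expSeries]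
    simp
  · simp only [coeff_succ_X_mul, coeff_rescale, sinhQuotient, coeff_mk, sinhSeries, map_sub,
      coeff_expSeries, neg_pow (c / 2), neg_pow ((1 : ℚ) / 2), div_pow]
    ring

/-- The power series `∑ k, q_k exp ((k - (d - 1) / 2) u)` for `Q = ∑ k, q_k X ^ k`. When `Q`
collects the signed values of the hook characters, its coefficients are the moments of the centred
leg lengths. -/
def centeredExpSum (d : ℕ) (Q : Polynomial ℚ) : PowerSeries ℚ :=
  expSeries (-(((d : ℚ) - 1) / 2)) * Polynomial.aeval (exp ℚ) Q

theorem sum_coeff_mul_pow {d : ℕ} {Q : Polynomial ℚ} (hdeg : Q.natDegree < d) (j : ℕ) :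
    ∑ k : Fin d, Q.coeff k * ((k : ℚ) - ((d : ℚ) - 1) / 2) ^ j =
      j.factorial * coeff j (centeredExpSum d Q) := by
  have hj : (j.factorial : ℚ) ≠ 0 := Nat.cast_ne_zero.2 j.factorial_ne_zero
  rw [Fin.sum_univ_eq_sum_range fun k : ℕ => Q.coeff k * ((k : ℚ) - ((d : ℚ) - 1) / 2) ^ j,
    centeredExpSum, Polynomial.aeval_eq_sum_range' hdeg, mul_sum, map_sum, mul_sum]
  refine sum_congr rfl fun k _ => ?_
  rw [← expSeries_natCast, mul_smul_comm, ← expSeries_add, neg_add_eq_sub, coeff_smul,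
    coeff_expSeries, smul_eq_mul, mul_left_comm, mul_div_cancel₀ _ hj]

variable {n : ℕ} {beta : Fin n → ℕ} {Q : Polynomial ℚ}

theorem centeredExpSum_mul_sinhSeries (hn : Odd n)
    (hQ : (1 - Polynomial.X) * Q = ∏ i, (1 - Polynomial.X ^ beta i)) :
    centeredExpSum (∑ i, beta i) Q * sinhSeries 1 = ∏ i, sinhSeries (beta i) := by
  have hexp : (1 - expSeries 1) * Polynomial.aeval (exp ℚ) Q = ∏ i, (1 - expSeries (beta i)) := by
    have h := congrArg (Polynomial.aeval (exp ℚ)) hQ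
    simpa [expSeries_natCast, show expSeries 1 = exp ℚ by simp [expSeries]] using h
  have hhalves : ∏ i, expSeries ((beta i : ℚ) / 2) =
      expSeries (1 / 2) * expSeries ((((∑ i, beta i : ℕ) : ℚ) - 1) / 2) := by
    rw [← expSeries_sum, ← expSeries_add, ← sum_div, Nat.cast_sum]
    ring_nf
  have hcancel (c : ℚ) : expSeries (-c) * expSeries c = 1 := by
    rw [← expSeries_add, neg_add_cancel, expSeries_zero]
  simp only [one_sub_expSeries, prod_neg, prod_mul_distrib, card_univ, Fintype.card_fin,
    hn.neg_one_pow, hhalves] at hexp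
  set c := (((∑ i, beta i : ℕ) : ℚ) - 1) / 2
  rw [centeredExpSum]
  linear_combination (-expSeries (-c) * expSeries (-(1 / 2))) * hexp +
    ((∏ i, sinhSeries (beta i)) * expSeries (-c) * expSeries c -
      expSeries (-c) * Polynomial.aeval (exp ℚ) Q * sinhSeries 1) * hcancel (1 / 2) +
    (∏ i, sinhSeries (beta i)) * hcancel c

theorem centeredExpSum_eq (hn : Odd n)
    (hQ : (1 - Polynomial.X) * Q = ∏ i, (1 - Polynomial.X ^ beta i)) :
    centeredExpSum (∑ i, beta i) Q = C (∏ i, (beta i : ℚ)) *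
      (X ^ (n - 1) * ((∏ i, rescale (beta i : ℚ) sinhQuotient) * sinhQuotient⁻¹)) := by
  have hS : sinhQuotient * sinhQuotient⁻¹ = 1 :=
    PowerSeries.mul_inv_cancel _ (constantCoeff_sinhQuotient ▸ one_ne_zero)
  have h := centeredExpSum_mul_sinhSeries hn hQ
  simp only [sinhSeries_eq, prod_mul_distrib, prod_const, card_univ, Fintype.card_fin, map_one,
    one_mul, rescale_one, RingHom.id_apply, ← map_prod] at h
  rw [← pow_sub_one_mul hn.pos.ne'] at h
  refine mul_right_cancel₀ (X_ne_zero (R := ℚ)) ?_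
  linear_combination sinhQuotient⁻¹ * h - centeredExpSum (∑ i, beta i) Q * X * hS

/-- The coefficient of `u ^ j / j!` in `u ^ (n - 1) * ∏ i, 𝒮(X_i u) / 𝒮(u)`. -/
def momentPoly (n j : ℕ) : MvPolynomial (Fin n) ℚ :=
  MvPolynomial.C (j.factorial : ℚ) * coeff j (X ^ (n - 1) *
    ((∏ i, rescale (MvPolynomial.X i) (map MvPolynomial.C sinhQuotient)) *
      map MvPolynomial.C sinhQuotient⁻¹))

theorem eval_momentPoly (x : Fin n → ℚ) (j : ℕ) :
    MvPolynomial.eval x (momentPoly n j) = j.factorial * coeff j (X ^ (n - 1) *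
      ((∏ i, rescale (x i) sinhQuotient) * sinhQuotient⁻¹)) := by
  have hrescale (i : Fin n) : map (MvPolynomial.eval x)
      (rescale (MvPolynomial.X i) (map MvPolynomial.C sinhQuotient)) =
      rescale (x i) sinhQuotient := by
    ext m
    simp [coeff_rescale]
  have hinv : map (MvPolynomial.eval x) (map MvPolynomial.C sinhQuotient⁻¹) = sinhQuotient⁻¹ := by
    ext m
    simp
  simp only [momentPoly, map_mul, MvPolynomial.eval_C, ← coeff_map, map_pow, map_X, map_prod,
    hrescale, hinv]

theorem constantCoeff_momentPoly (n j : ℕ) :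
    MvPolynomial.constantCoeff (momentPoly n (j + (n - 1))) =
      (j + (n - 1)).factorial * coeff j sinhQuotient⁻¹ := by
  rw [← MvPolynomial.eval_zero, eval_momentPoly, coeff_X_pow_mul]
  simp [rescale_zero, constantCoeff_sinhQuotient]

theorem sum_coeff_mul_pow_eq_eval_momentPoly (hn : Odd n)
    (hQ : (1 - Polynomial.X) * Q = ∏ i, (1 - Polynomial.X ^ beta i))
    (hdeg : Q.natDegree < ∑ i, beta i) (j : ℕ) :
    ∑ k : Fin (∑ i, beta i), Q.coeff k * ((k : ℚ) - (((∑ i, beta i : ℕ) : ℚ) - 1) / 2) ^ j =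
      (∏ i, (beta i : ℚ)) * MvPolynomial.eval (fun i => (beta i : ℚ)) (momentPoly n j) := by
  rw [sum_coeff_mul_pow hdeg, centeredExpSum_eq hn hQ, coeff_C_mul, eval_momentPoly, mul_left_comm]

end Series

section HurwitzPolynomial

/-- The cofactor of `(X₁ + … + X_n) ^ s` in the polynomial `d H^{g,(2)}_{(d),β} / s!`. It comes from
expanding the `s`-th power of `p₃ / 3! = d / 2 * (x ^ 2 + d ^ 2 / 12)`, where `x` is the centred leg
length of a hook. -/
def hurwitzCofactor (n s : ℕ) : MvPolynomial (Fin n) ℚ :=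
  MvPolynomial.C ((s.factorial : ℚ) * 2 ^ s)⁻¹ * ∑ m ∈ range (s + 1), momentPoly n (2 * m) *
    (MvPolynomial.C (1 / 12) * (∑ i, MvPolynomial.X i) ^ 2) ^ (s - m) *
      MvPolynomial.C (s.choose m : ℚ)

theorem constantCoeff_hurwitzCofactor (n s : ℕ) :
    MvPolynomial.constantCoeff (hurwitzCofactor n s) =
      ((s.factorial : ℚ) * 2 ^ s)⁻¹ * MvPolynomial.constantCoeff (momentPoly n (2 * s)) := by
  rw [hurwitzCofactor, map_mul, MvPolynomial.constantCoeff_C, map_sum, sum_range_succ,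
    sum_eq_zero, zero_add]
  · simp
  · intro m hm
    have hsm : s - m ≠ 0 := Nat.sub_ne_zero_of_lt (mem_range.1 hm)
    simp [hsm]

theorem sum_coeff_mul_quadratic_pow {n : ℕ} {beta : Fin n → ℕ} {Q : Polynomial ℚ} (hn : Odd n)
    (hQ : (1 - Polynomial.X) * Q = ∏ i, (1 - Polynomial.X ^ beta i))
    (hdeg : Q.natDegree < ∑ i, beta i) (x : ℚ) (s : ℕ) :
    ∑ k : Fin (∑ i, beta i), Q.coeff k *
        ((k - (((∑ i, beta i : ℕ) : ℚ) - 1) / 2) ^ 2 + x) ^ s =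
      (∏ i, (beta i : ℚ)) * ∑ m ∈ range (s + 1),
        MvPolynomial.eval (fun i => (beta i : ℚ)) (momentPoly n (2 * m)) * x ^ (s - m) *
          s.choose m := by
  simp only [add_pow, mul_sum]
  rw [sum_comm]
  refine sum_congr rfl fun m _ => ?_
  rw [← mul_assoc, ← mul_assoc, ← sum_coeff_mul_pow_eq_eval_momentPoly hn hQ hdeg, sum_mul, sum_mul]
  refine sum_congr rfl fun k _ => ?_
  rw [← pow_mul, mul_assoc, mul_assoc, mul_assoc]

theorem eval_sum_X_pow_mul_hurwitzCofactor {n : ℕ} {beta : Fin n → ℕ} {Q : Polynomial ℚ}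
    (hn : Odd n) (hQ : (1 - Polynomial.X) * Q = ∏ i, (1 - Polynomial.X ^ beta i))
    (hdeg : Q.natDegree < ∑ i, beta i) (s : ℕ) :
    (∏ i, (beta i : ℚ)) * s.factorial * MvPolynomial.eval (fun i => (beta i : ℚ))
        ((∑ i, MvPolynomial.X i) ^ s * hurwitzCofactor n s) =
      ∑ k : Fin (∑ i, beta i), Q.coeff k * (((∑ i, beta i : ℕ) : ℚ) / 2 *
        ((k - (((∑ i, beta i : ℕ) : ℚ) - 1) / 2) ^ 2 + ((∑ i, beta i : ℕ) : ℚ) ^ 2 / 12)) ^ s := by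
  have hsum := sum_coeff_mul_quadratic_pow hn hQ hdeg (((∑ i, beta i : ℕ) : ℚ) ^ 2 / 12) s
  have hs : (s.factorial : ℚ) ≠ 0 := Nat.cast_ne_zero.2 s.factorial_ne_zero
  have hX : MvPolynomial.eval (fun i => (beta i : ℚ)) (∑ i, MvPolynomial.X i) =
      ((∑ i, beta i : ℕ) : ℚ) := by simp
  simp only [mul_pow, mul_left_comm (Polynomial.coeff _ _), ← mul_sum, hsum]
  simp only [hurwitzCofactor, map_mul, map_pow, map_sum _ _ (range _), hX, MvPolynomial.eval_C,
    one_div_mul_eq_div, div_pow _ (2 : ℚ)]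
  field_simp

theorem ofTuple_parts {n : ℕ} {beta : Fin n → ℕ} (h : ∀ i, 0 < beta i) :
    (ofTuple beta).parts = Finset.univ.val.map beta := by
  refine (Nat.Partition.ofSums_parts _ (Finset.univ.val.map beta) rfl).trans ?_
  rw [Multiset.filter_eq_self]
  intro a ha
  obtain ⟨i, _, rfl⟩ := Multiset.mem_map.1 ha
  exact (h i).ne'

variable {g n r : ℕ}

theorem numCycles_indiscrete_ofTuple (hn : n = 2 * r + 1) {beta : Fin n → ℕ}
    (h : ∀ i, 0 < beta i) (hd : ∑ i, beta i ≠ 0) :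
    numCycles g 2 (Nat.Partition.indiscrete (∑ i, beta i)) (ofTuple beta) = g + r := by
  rw [numCycles, Nat.Partition.indiscrete_parts hd, ofTuple_parts h, Multiset.card_singleton,
    Multiset.card_map, card_val, card_univ, Fintype.card_fin]
  omega

theorem charpolyRev_permMatrix_permOfType_ofTuple {beta : Fin n → ℕ} (h : ∀ i, 0 < beta i) :
    ((permOfType (ofTuple beta)).permMatrix ℚ).charpolyRev =
      ∏ i, (1 - Polynomial.X ^ beta i) := by
  rw [charpolyRev_permMatrix, partition_permOfType, ofTuple_parts h, Multiset.map_map]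
  rfl

theorem isHurwitzPolynomial_sum_X_pow_mul (hn : n = 2 * r + 1) :
    IsHurwitzPolynomial g n ((∑ i, MvPolynomial.X i) ^ (g + r) * hurwitzCofactor n (g + r)) := by
  intro beta hbeta
  have : NeZero n := ⟨by omega⟩
  have hd : 0 < ∑ i, beta i := sum_pos (fun i _ => hbeta i) univ_nonempty
  have : Nonempty (Fin (∑ i, beta i)) := ⟨⟨0, hd⟩⟩
  have hQ : (1 - Polynomial.X) * hookPoly (permOfType (ofTuple beta)) =
      ∏ i, (1 - Polynomial.X ^ beta i) := by
    rw [one_sub_X_mul_hookPoly, charpolyRev_permMatrix_permOfType_ofTuple hbeta]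
  have hdeg : (hookPoly (permOfType (ofTuple beta))).natDegree < ∑ i, beta i := by
    simpa using natDegree_hookPoly_lt (permOfType (ofTuple beta))
  have hprod : ((ofTuple beta).parts.prod : ℚ) = ∏ i, (beta i : ℚ) := by
    rw [ofTuple_parts hbeta]
    exact Nat.cast_prod _ _
  have hprod0 : ∏ i, (beta i : ℚ) ≠ 0 :=
    prod_ne_zero_iff.2 fun i _ => Nat.cast_ne_zero.2 (hbeta i).ne'
  rw [doubleHurwitz, numCycles_indiscrete_ofTuple hn hbeta hd.ne',
    sum_chi_indiscrete_mul_mul_chi hd.ne' fun lam =>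
      (shiftedPowerSum (2 + 1) lam / (Nat.factorial (2 + 1) : ℚ)) ^ (g + r)]
  simp only [shiftedPowerSum_three_hook]
  rw [← eval_sum_X_pow_mul_hurwitzCofactor ⟨r, hn⟩ hQ hdeg, hprod,
    Nat.Partition.indiscrete_parts hd.ne', Multiset.prod_singleton]
  have hs : ((g + r).factorial : ℚ) ≠ 0 := Nat.cast_ne_zero.2 (Nat.factorial_ne_zero _)
  have hd0 : ((∑ i, beta i : ℕ) : ℚ) ≠ 0 := Nat.cast_ne_zero.2 hd.ne'
  field_simp

theorem IsHurwitzPolynomial.unique {P P' : MvPolynomial (Fin n) ℚ}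
    (h : IsHurwitzPolynomial g n P) (h' : IsHurwitzPolynomial g n P') : P = P' := by
  refine MvPolynomial.funext_set (fun _ => Set.range fun k : ℕ => ((k + 1 : ℕ) : ℚ))
    (fun _ => Set.infinite_range_of_injective fun a b hab => by simpa using hab) fun x hx => ?_
  choose k hk using fun i => hx i (Set.mem_univ i)
  obtain rfl : (fun i => ((k i + 1 : ℕ) : ℚ)) = x := funext hk
  rw [h _ fun _ => Nat.succ_pos _, h' _ fun _ => Nat.succ_pos _]

theorem hurwitzPolynomial_eq (hn : n = 2 * r + 1) :
    hurwitzPolynomial g n = (∑ i, MvPolynomial.X i) ^ (g + r) * hurwitzCofactor n (g + r) := by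
  have h : ∃ P, IsHurwitzPolynomial g n P := ⟨_, isHurwitzPolynomial_sum_X_pow_mul hn⟩
  rw [hurwitzPolynomial, dif_pos h]
  exact h.choose_spec.unique (isHurwitzPolynomial_sum_X_pow_mul hn)

end HurwitzPolynomial

section HodgeIntegral

theorem coeff_mul_of_isHomogeneous {σ R : Type*} [CommSemiring R] {φ : MvPolynomial σ R} {m : ℕ}
    (hφ : φ.IsHomogeneous m) (ψ : MvPolynomial σ R) {b : σ →₀ ℕ} (hb : b.degree = m) :
    (φ * ψ).coeff b = φ.coeff b * MvPolynomial.constantCoeff ψ := by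
  classical
  rw [MvPolynomial.coeff_mul, MvPolynomial.constantCoeff_eq]
  refine sum_eq_single (b, 0) (fun p hp hne => ?_) fun h => absurd (by simp) h
  obtain ⟨c, e⟩ := p
  obtain rfl : c + e = b := HasAntidiagonal.mem_antidiagonal.1 hp
  rw [hφ.coeff_eq_zero, zero_mul]
  intro hc
  rw [map_add, hc, Nat.add_eq_left, Finsupp.degree_eq_zero_iff] at hb
  exact hne (by rw [hb, add_zero])

theorem coeff_sum_X_pow_mul {n : ℕ} (ψ : MvPolynomial (Fin n) ℚ) (b : Fin n →₀ ℕ) :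
    ((∑ i, MvPolynomial.X i) ^ (∑ i, b i) * ψ).coeff b =
      (∑ i, b i).factorial / (∏ i, ((b i).factorial : ℚ)) * MvPolynomial.constantCoeff ψ := by
  have hhom : ((∑ i, MvPolynomial.X i : MvPolynomial (Fin n) ℚ) ^ (∑ i, b i)).IsHomogeneous
      (∑ i, b i) := by
    simpa using (MvPolynomial.IsHomogeneous.sum univ MvPolynomial.X 1 fun i _ =>
      MvPolynomial.isHomogeneous_X ℚ i).pow (∑ i, b i)
  rw [coeff_mul_of_isHomogeneous hhom ψ (Finsupp.degree_eq_sum b),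
    MvPolynomial.coeff_sum_X_pow_of_fintype, if_pos (Finsupp.sum_fintype _ _ fun _ => rfl),
    Finsupp.multinomial_eq_of_support_subset (subset_univ b.support)]
  congr 1
  rw [eq_div_iff (prod_ne_zero_iff.2 fun i _ => Nat.cast_ne_zero.2 (b i).factorial_ne_zero),
    mul_comm, ← Nat.multinomial_spec univ b, Nat.cast_mul, Nat.cast_prod]

/-- The value `1 / Γ(m + 1)`, that is `1 / m!` for `0 ≤ m` and `0` for `m < 0`. -/
def invFactorial (m : ℤ) : ℚ := if 0 ≤ m then (m.toNat.factorial : ℚ)⁻¹ else 0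

theorem invFactorial_natCast (m : ℕ) : invFactorial m = (m.factorial : ℚ)⁻¹ := by
  simp [invFactorial]

theorem invFactorial_sub_one (m : ℤ) : invFactorial (m - 1) = m * invFactorial m := by
  rcases lt_trichotomy m 0 with hm | rfl | hm
  · rw [invFactorial, invFactorial, if_neg (by lia), if_neg (by lia), mul_zero]
  · simp [invFactorial]
  · obtain ⟨k, rfl⟩ : ∃ k : ℕ, m = (k + 1 : ℕ) := ⟨(m - 1).toNat, by lia⟩
    rw [Nat.cast_succ, add_sub_cancel_right, ← Nat.cast_succ, invFactorial_natCast,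
      invFactorial_natCast, Nat.factorial_succ]
    have : (k.factorial : ℚ) ≠ 0 := Nat.cast_ne_zero.2 k.factorial_ne_zero
    push_cast
    field_simp

theorem prod_invFactorial_update_sub_one {ι : Type*} [Fintype ι] [DecidableEq ι] (b : ι → ℤ)
    (i : ι) :
    ∏ j, invFactorial (Function.update b i (b i - 1) j) = b i * ∏ j, invFactorial (b j) := by
  rw [← mul_prod_erase _ _ (mem_univ i), ← mul_prod_erase _ (fun j => invFactorial (b j))
    (mem_univ i), Function.update_self, invFactorial_sub_one, mul_assoc]
  congr 2
  exact prod_congr rfl fun j hj => by rw [Function.update_of_ne (ne_of_mem_erase hj)]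

/-- The common value of `b₁! ⋯ b_n! ⟨⟨τ_{b₁} ⋯ τ_{b_n} Λ_{2g}⟩⟩_g` for `n = 2 r + 1`. -/
def hodgeConstant (g r : ℕ) : ℚ :=
  (-1) ^ g * PowerSeries.coeff (2 * g) sinhQuotient⁻¹ * ((2 * (g + r)).factorial / 2 ^ (g + r))

theorem hodgeConstant_succ (g r : ℕ) :
    hodgeConstant g (r + 1) = (2 * g + 2 * r + 1) * (g + r + 1) * hodgeConstant g r := by
  rw [hodgeConstant, hodgeConstant, ← add_assoc, mul_add 2 (g + r), Nat.factorial_succ,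
    Nat.factorial_succ, pow_succ]
  push_cast
  ring

variable {g n r : ℕ}

theorem hodgeIntegral_eq (hn : n = 2 * r + 1) {b : Fin n → ℤ} (hb : ∑ i, (b i : ℚ) = g + r) :
    hodgeIntegral g g b = hodgeConstant g r * ∏ i, invFactorial (b i) := by
  by_cases hpos : ∀ i, 0 ≤ b i
  · lift b to Fin n → ℕ using hpos
    have hsum : ∑ i, b i = g + r := by exact_mod_cast hb
    have hcoeff : (hurwitzPolynomial g n).coeff (Finsupp.equivFunOnFinite.symm b) =
        (g + r).factorial / (∏ i, ((b i).factorial : ℚ)) *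
          MvPolynomial.constantCoeff (hurwitzCofactor n (g + r)) := by
      rw [hurwitzPolynomial_eq hn, ← hsum]
      exact coeff_sum_X_pow_mul _ (Finsupp.equivFunOnFinite.symm b)
    rw [hodgeIntegral, if_pos ⟨fun i => Int.natCast_nonneg _, by rw [hb, hn]; push_cast; ring⟩]
    simp only [Int.toNat_natCast, invFactorial_natCast]
    rw [hcoeff, constantCoeff_hurwitzCofactor, show 2 * (g + r) = 2 * g + (n - 1) by lia,
      constantCoeff_momentPoly, hodgeConstant, prod_inv_distrib,
      show 2 * (g + r) = 2 * g + (n - 1) by lia]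
    have hs : ((g + r).factorial : ℚ) ≠ 0 := Nat.cast_ne_zero.2 (Nat.factorial_ne_zero _)
    field_simp
  · rw [hodgeIntegral, if_neg fun h => hpos h.1]
    obtain ⟨i, hi⟩ := not_forall.1 hpos
    rw [prod_eq_zero (mem_univ i) (if_neg hi), mul_zero]

theorem hodgeIntegral_cons_cons (hn : n = 2 * r + 1) {b : Fin n → ℤ} {a c : ℤ}
    (hb : (a : ℚ) + c + ∑ i, (b i : ℚ) = g + r + 1) :
    hodgeIntegral g g (Matrix.vecCons a (Matrix.vecCons c b)) = (2 * g + n) * (g + r + 1) *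
      (invFactorial a * invFactorial c * (hodgeConstant g r * ∏ i, invFactorial (b i))) := by
  subst hn
  rw [hodgeIntegral_eq (r := r + 1) (by lia), hodgeConstant_succ, Fin.prod_univ_succ,
    Fin.prod_univ_succ]
  · simp only [Matrix.cons_val_zero, Matrix.cons_val_succ]
    push_cast
    ring
  · rw [Fin.sum_univ_succ, Fin.sum_univ_succ]
    simp only [Matrix.cons_val_zero, Matrix.cons_val_succ]
    push_cast
    linarith

theorem sum_hodgeIntegral_update_sub_one (hn : n = 2 * r + 1) {b : Fin n → ℤ}
    (hb : ∑ i, (b i : ℚ) = g + r + 1) :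
    ∑ i, hodgeIntegral g g (Function.update b i (b i - 1)) =
      (g + r + 1) * (hodgeConstant g r * ∏ i, invFactorial (b i)) := by
  have hsum (i : Fin n) : ∑ j, (Function.update b i (b i - 1) j : ℚ) = g + r := by
    rw [← Int.cast_sum, sum_update_of_mem (mem_univ i), Int.cast_add, Int.cast_sub, Int.cast_one,
      sub_add_eq_add_sub, ← Int.cast_add, ← sum_eq_add_sum_sdiff_singleton_of_mem (mem_univ i) b,
      Int.cast_sum, hb, add_sub_cancel_right]
  simp only [hodgeIntegral_eq hn (hsum _), prod_invFactorial_update_sub_one]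
  rw [← hb, ← mul_sum, ← sum_mul]
  ring

theorem hodgeIntegral_string (hn : n = 2 * r + 1) {b : Fin n → ℤ}
    (hb : ∑ i, (b i : ℚ) = g + r + 1) :
    hodgeIntegral g g (Matrix.vecCons 0 (Matrix.vecCons 0 b)) =
      (2 * g + n) * ∑ i, hodgeIntegral g g (Function.update b i (b i - 1)) := by
  rw [hodgeIntegral_cons_cons hn (by simpa using hb), sum_hodgeIntegral_update_sub_one hn hb,
    show invFactorial 0 = 1 by simp [invFactorial]]
  ring

theorem hodgeIntegral_dilaton (hn : n = 2 * r + 1) {b : Fin n → ℤ}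
    (hb : ∑ i, (b i : ℚ) = g + r) :
    hodgeIntegral g g (Matrix.vecCons 0 (Matrix.vecCons 1 b)) =
      (2 * g + n) * (g + r + 1) * hodgeIntegral g g b := by
  rw [hodgeIntegral_cons_cons hn (by rw [hb]; push_cast; ring), hodgeIntegral_eq hn hb]
  simp [invFactorial]

end HodgeIntegral

end CompletedHurwitz

end

theorem proposition4p3 (g n : ℕ) (hn : Odd n) :
    -- the combinatorial Hodge integrals are well defined
    (∃! P : MvPolynomial (Fin n) ℚ, IsHurwitzPolynomial g n P) ∧
    -- string equation
    (∀ b : Fin n → ℕ, (∑ i, (b i : ℚ)) = g + ((n : ℚ) + 1) / 2 →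
      hodgeIntegral g g (Matrix.vecCons 0 (Matrix.vecCons 0 fun j => (b j : ℤ))) =
        (2 * g + n) * ∑ i, hodgeIntegral g g
          (Function.update (fun j => (b j : ℤ)) i ((b i : ℤ) - 1))) ∧
    -- dilaton equation
    (∀ b : Fin n → ℕ, (∑ i, (b i : ℚ)) = g + ((n : ℚ) - 1) / 2 →
      hodgeIntegral g g (Matrix.vecCons 0 (Matrix.vecCons 1 fun j => (b j : ℤ))) =
        (2 * g + n) * (g + ((n : ℚ) + 1) / 2) * hodgeIntegral g g fun j => (b j : ℤ)) := by
  obtain ⟨r, hr⟩ := hn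
  have hrat : (n : ℚ) = 2 * r + 1 := by exact_mod_cast hr
  have hP := isHurwitzPolynomial_sum_X_pow_mul (g := g) hr
  refine ⟨⟨_, hP, fun P hP' => hP'.unique hP⟩, fun b hb => ?_, fun b hb => ?_⟩
  · refine hodgeIntegral_string hr ?_
    push_cast
    rw [hb, hrat]
    ring
  · have hsum : ∑ i, ((b i : ℤ) : ℚ) = g + r := by
      push_cast
      rw [hb, hrat]
      ring
    rw [hodgeIntegral_dilaton hr hsum, hrat]
    ring
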